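/- Let $\mathfrak g$ be the complex Lie superalgebra $\mathfrak{sl}_{m|n}$ with $m\neq n$, or $\mathfrak{psl}_{m|m}=\mathfrak{sl}_{m|m}/\mathbb C\,\mathrm{Id}$ (in which case $n=m$). Let $(e,x,f)$ be an $\mathfrak{sl}_2$-triple in the even part $\mathfrak g_{\bar 0}$, normalized by $[x,e]=e$, $[x,f]=-f$, $[e,f]=x$, and let $\mathfrak g^\natural$ be the centralizer of $\{e,x,f\}$ in $\mathfrak g$. Let $f$ be encoded by the pair of partitions $(\alpha|\beta)$, $\alpha\vdash m$, $\beta\vdash n$: under the triple (for $\mathfrak{psl}_{m|m}$, under a lift of it to an $\mathfrak{sl}_2$-triple in the even part of $\mathfrak{sl}_{m|m}$), $\mathbb C^m$ is the direct sum of irreducible $\mathfrak{sl}_2$-modules whose dimensions are the parts of $\alpha$, and $\mathbb C^n$ is the direct sum of irreducible $\mathfrak{sl}_2$-modules whose dimensions are the parts of $\beta$. Let $m_1,\dots,m_t$ be the distinct positive integers that occur as parts of $\alpha$ or of $\beta$. Assume that $\mathfrak g^\natural$ is a Lie algebra, i.e. has zero odd part. Then $\mathfrak g$ is a direct sum of irreducible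 $\mathfrak g^\natural\oplus\mathfrak{sl}_2$-modules, and in every such decomposition the number $\mathrm{mult}(\mathbb C\otimes\mathrm{adj})$ of summands isomorphic to the tensor product of the trivial representation $\mathbb C$ of $\mathfrak g^\natural$ and the adjoint representation of $\mathfrak{sl}_2$ is $$\mathrm{mult}(\mathbb C\otimes\mathrm{adj})=|\{m_i : m_i>1\}|.$$ In particular, $\mathrm{mult}(\mathbb C\otimes\mathrm{adj})=1$ if and only if, for some integers $q\ge 2$, $l\ge 1$ and (where it occurs) $r\ge 0$, the pair $(\alpha|\beta)$ is one of 1. $(q^l,1^r\,|\,0)$ with $m=ql+r$, $n=0$; or $(0\,|\,q^l,1^r)$ with $n=ql+r$, $m=0$; 2. $(q^l\,|\,1^n)$ with $m=ql$; or $(1^m\,|\,q^l)$ with $n=ql$. -/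

import Mathlib

/-! Complex Lie superalgebras, the superalgebras `gl(m|n)`, `sl(m|n)`, `psl(m|m)`, and
multiplicities in the decomposition under an `sl₂`-triple and its centralizer. -/

noncomputable section

/-- The Koszul sign `(-1)^{ij}` of two parities. -/
def koszulSign (i j : ZMod 2) : ℂ := (-1) ^ (i * j).val

/-- A complex Lie superalgebra structure on the vector space `V`: `part 0` is the even part and
`part 1` the odd part. -/
structure LieSuperalgebra (V : Type*) [AddCommGroup V] [Module ℂ V] where
  part : ZMod 2 → Submodule ℂ V
  isCompl : IsCompl (part 0) (part 1)
  bracket : V →ₗ[ℂ] V →ₗ[ℂ] V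
  bracket_mem : ∀ {i j : ZMod 2} {a b : V}, a ∈ part i → b ∈ part j → bracket a b ∈ part (i + j)
  skew : ∀ {i j : ZMod 2} {a b : V}, a ∈ part i → b ∈ part j →
    bracket a b = -(koszulSign i j • bracket b a)
  jacobi : ∀ {i j k : ZMod 2} {a b c : V}, a ∈ part i → b ∈ part j → c ∈ part k →
    bracket a (bracket b c) = bracket (bracket a b) c + koszulSign i j • bracket b (bracket a c)

namespace LieSuperalgebra

variable {V : Type*} [AddCommGroup V] [Module ℂ V]

/-- A subspace is graded if it contains the homogeneous components of its elements. -/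
def IsGraded (A : LieSuperalgebra V) (W : Submodule ℂ V) : Prop :=
  ∀ w ∈ W, ∃ a ∈ W ⊓ A.part 0, ∃ b ∈ W ⊓ A.part 1, w = a + b

/-- The Lie superalgebra structure on a graded subspace closed under the bracket. -/
def sub (A : LieSuperalgebra V) (W : Submodule ℂ V) (hW : A.IsGraded W)
    (hb : ∀ a ∈ W, ∀ b ∈ W, A.bracket a b ∈ W) : LieSuperalgebra W where
  part i := (A.part i).comap W.subtype
  isCompl := by
    constructor
    · rw [Submodule.disjoint_def]
      intro a h0 h1
      exact Subtype.ext (Submodule.disjoint_def.1 A.isCompl.disjoint _ h0 h1)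
    · rw [codisjoint_iff, Submodule.eq_top_iff']
      rintro ⟨w, hw⟩
      obtain ⟨a, ha, b, hb, rfl⟩ := hW w hw
      exact Submodule.mem_sup.2 ⟨⟨a, ha.1⟩, ha.2, ⟨b, hb.1⟩, hb.2, rfl⟩
  bracket := LinearMap.mk₂ ℂ (fun a b => ⟨A.bracket a b, hb a a.2 b b.2⟩)
    (fun _ _ _ => Subtype.ext (by simp)) (fun _ _ _ => Subtype.ext (by simp))
    (fun _ _ _ => Subtype.ext (by simp)) (fun _ _ _ => Subtype.ext (by simp))
  bracket_mem ha hb := A.bracket_mem ha hb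
  skew ha hb := Subtype.ext (A.skew ha hb)
  jacobi ha hb hc := Subtype.ext (A.jacobi ha hb hc)

/-- The Lie superalgebra structure on the quotient by a graded (two-sided) ideal. -/
def quot (A : LieSuperalgebra V) (I : Submodule ℂ V) (hI : A.IsGraded I)
    (hl : ∀ a, ∀ b ∈ I, A.bracket a b ∈ I) (hr : ∀ a ∈ I, ∀ b, A.bracket a b ∈ I) :
    LieSuperalgebra (V ⧸ I) where
  part i := (A.part i).map I.mkQ
  isCompl := by
    constructor
    · rw [Submodule.disjoint_def]
      rintro _ ⟨a, ha, rfl⟩ ⟨b, hb, hab⟩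
      have h : a - b ∈ I := (Submodule.Quotient.eq I).1 hab.symm
      obtain ⟨c, hc, d, hd, hcd⟩ := hI _ h
      have h1 : a - c = b + d := by
        rw [sub_eq_iff_eq_add] at hcd
        rw [hcd]; abel
      have h2 : a - c = 0 := Submodule.disjoint_def.1 A.isCompl.disjoint _
        ((A.part 0).sub_mem ha hc.2) (h1 ▸ (A.part 1).add_mem hb hd.2)
      rw [sub_eq_zero.1 h2]
      exact (Submodule.Quotient.mk_eq_zero I).2 hc.1
    · rw [codisjoint_iff, ← Submodule.map_sup, codisjoint_iff.1 A.isCompl.codisjoint,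
        Submodule.map_top, Submodule.range_mkQ]
  bracket := I.liftQ ((I.mapQLinear I).comp
      (A.bracket.codRestrict (I.compatibleMaps I) (fun a b hb => hl a b hb))) (by
    intro a ha
    rw [LinearMap.mem_ker]
    ext b
    exact (Submodule.Quotient.mk_eq_zero I).2 (hr a ha b))
  bracket_mem := by
    rintro i j _ _ ⟨a, ha, rfl⟩ ⟨b, hb, rfl⟩
    exact ⟨_, A.bracket_mem ha hb, rfl⟩
  skew := by
    rintro i j _ _ ⟨a, ha, rfl⟩ ⟨b, hb, rfl⟩
    exact congrArg I.mkQ (A.skew ha hb)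
  jacobi := by
    rintro i j k _ _ _ ⟨a, ha, rfl⟩ ⟨b, hb, rfl⟩ ⟨c, hc, rfl⟩
    exact congrArg I.mkQ (A.jacobi ha hb hc)

/-- `(e, x, f)` is an `sl₂`-triple in the even part, normalized by `[x, e] = e`, `[x, f] = -f`,
`[e, f] = x`. -/
structure IsEvenSl2Triple (A : LieSuperalgebra V) (e x f : V) : Prop where
  e_even : e ∈ A.part 0
  x_even : x ∈ A.part 0
  f_even : f ∈ A.part 0
  x_e : A.bracket x e = e
  x_f : A.bracket x f = -f
  e_f : A.bracket e f = x

/-- The centralizer of `e, x, f`. -/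
def natural (A : LieSuperalgebra V) (e x f : V) : Submodule ℂ V :=
  LinearMap.ker (A.bracket e) ⊓ LinearMap.ker (A.bracket x) ⊓ LinearMap.ker (A.bracket f)

/-- `W` is stable under the centralizer of the triple and under the triple, i.e. it is a submodule
of `V` for `natural ⊕ sl₂`. -/
def IsStable (A : LieSuperalgebra V) (e x f : V) (W : Submodule ℂ V) : Prop :=
  ∀ w ∈ W, (∀ z ∈ A.natural e x f, A.bracket z w ∈ W) ∧
    A.bracket e w ∈ W ∧ A.bracket x w ∈ W ∧ A.bracket f w ∈ W

/-- `W` is an irreducible submodule of `V` for `natural ⊕ sl₂`. -/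
def IsIrred (A : LieSuperalgebra V) (e x f : V) (W : Submodule ℂ V) : Prop :=
  A.IsStable e x f W ∧ W ≠ ⊥ ∧
    ∀ U : Submodule ℂ V, U ≤ W → A.IsStable e x f U → U = ⊥ ∨ U = W

/-- `W` is isomorphic, as a `natural ⊕ sl₂`-module, to the tensor product of the trivial
representation of `natural` and the adjoint representation of `sl₂`: it has a basis
`(u 0, u 1, u 2)` killed by `natural`, on which `e, x, f` act as they do on
the basis `(e, x, f)` of `sl₂`. -/
def IsTrivAdj (A : LieSuperalgebra V) (e x f : V) (W : Submodule ℂ V) : Prop :=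
  ∃ u : Fin 3 → V, LinearIndependent ℂ u ∧ Submodule.span ℂ (Set.range u) = W ∧
    (∀ z ∈ A.natural e x f, ∀ j, A.bracket z (u j) = 0) ∧
    (A.bracket e (u 0) = 0 ∧ A.bracket e (u 1) = -u 0 ∧ A.bracket e (u 2) = u 1) ∧
    (A.bracket x (u 0) = u 0 ∧ A.bracket x (u 1) = 0 ∧ A.bracket x (u 2) = -u 2) ∧
    (A.bracket f (u 0) = -u 1 ∧ A.bracket f (u 1) = u 2 ∧ A.bracket f (u 2) = 0)

/-- A decomposition of `V` as a direct sum of irreducible `natural ⊕ sl₂`-submodules. -/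
def IsDecomposition (A : LieSuperalgebra V) (e x f : V) {r : ℕ}
    (ρ : Fin r → Submodule ℂ V) : Prop :=
  DirectSum.IsInternal ρ ∧ ∀ i, A.IsIrred e x f (ρ i)

/-- The multiplicity of (trivial) ⊗ (adjoint) in `V` is `k`: `V` is a direct sum of irreducible
`natural ⊕ sl₂`-submodules, and in every such decomposition exactly `k` summands are
isomorphic to (trivial) ⊗ (adjoint). -/
def MultTrivAdjEq (A : LieSuperalgebra V) (e x f : V) (k : ℕ) : Prop :=
  (∃ (r : ℕ) (ρ : Fin r → Submodule ℂ V), A.IsDecomposition e x f ρ) ∧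
    ∀ (r : ℕ) (ρ : Fin r → Submodule ℂ V), A.IsDecomposition e x f ρ →
      Set.ncard {i | A.IsTrivAdj e x f (ρ i)} = k

end LieSuperalgebra

/-- The underlying space of `gl(m|n)`. -/
abbrev SuperMatrix (m n : ℕ) : Type := Matrix (Fin m ⊕ Fin n) (Fin m ⊕ Fin n) ℂ

namespace SuperMatrix

variable {m n : ℕ}

/-- The block diagonal part of a supermatrix. -/
def evenPart : SuperMatrix m n →ₗ[ℂ] SuperMatrix m n where
  toFun a := Matrix.fromBlocks a.toBlocks₁₁ 0 0 a.toBlocks₂₂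
  map_add' a b := by ext (i | i) (j | j) <;> simp [Matrix.toBlocks₁₁, Matrix.toBlocks₂₂]
  map_smul' c a := by ext (i | i) (j | j) <;> simp [Matrix.toBlocks₁₁, Matrix.toBlocks₂₂]

/-- The block antidiagonal part of a supermatrix. -/
def oddPart : SuperMatrix m n →ₗ[ℂ] SuperMatrix m n where
  toFun a := Matrix.fromBlocks 0 a.toBlocks₁₂ a.toBlocks₂₁ 0
  map_add' a b := by ext (i | i) (j | j) <;> simp [Matrix.toBlocks₁₂, Matrix.toBlocks₂₁]
  map_smul' c a := by ext (i | i) (j | j) <;> simp [Matrix.toBlocks₁₂, Matrix.toBlocks₂₁]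

/-- Even supermatrices are the block diagonal ones, odd ones the block antidiagonal ones. -/
def part (i : ZMod 2) : Submodule ℂ (SuperMatrix m n) :=
  if i = 0 then LinearMap.ker oddPart else LinearMap.ker evenPart

theorem even_add_odd (a : SuperMatrix m n) : evenPart a + oddPart a = a := by
  ext (i | i) (j | j) <;>
    simp [evenPart, oddPart, Matrix.toBlocks₁₁, Matrix.toBlocks₂₂, Matrix.toBlocks₁₂,
      Matrix.toBlocks₂₁]

theorem mem_part_zero {a : SuperMatrix m n} : a ∈ part 0 ↔ oddPart a = 0 := by simp [part]

theorem mem_part_one {a : SuperMatrix m n} : a ∈ part 1 ↔ evenPart a = 0 := by simp [part]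

theorem evenPart_mem (a : SuperMatrix m n) : evenPart a ∈ part 0 := by
  rw [mem_part_zero]
  ext (i | i) (j | j) <;> simp [evenPart, oddPart, Matrix.toBlocks₁₂, Matrix.toBlocks₂₁]

theorem oddPart_mem (a : SuperMatrix m n) : oddPart a ∈ part 1 := by
  rw [mem_part_one]
  ext (i | i) (j | j) <;> simp [evenPart, oddPart, Matrix.toBlocks₁₁, Matrix.toBlocks₂₂]

theorem evenPart_of_mem {a : SuperMatrix m n} (h : a ∈ part 0) : evenPart a = a := by
  simpa [mem_part_zero.1 h] using even_add_odd a

theorem oddPart_of_mem {a : SuperMatrix m n} (h : a ∈ part 1) : oddPart a = a := by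
  simpa [mem_part_one.1 h] using even_add_odd a

theorem mul_mem {i j : ZMod 2} {a b : SuperMatrix m n} (ha : a ∈ part i) (hb : b ∈ part j) :
    a * b ∈ part (i + j) := by
  fin_cases i <;> fin_cases j
  · change a ∈ part 0 at ha
    change b ∈ part 0 at hb
    change a * b ∈ part 0
    rw [← evenPart_of_mem ha, ← evenPart_of_mem hb, mem_part_zero]
    simp [evenPart, oddPart, Matrix.fromBlocks_multiply]
  · change a ∈ part 0 at ha
    change b ∈ part 1 at hb
    change a * b ∈ part 1
    rw [← evenPart_of_mem ha, ← oddPart_of_mem hb, mem_part_one]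
    simp [evenPart, oddPart, Matrix.fromBlocks_multiply]
  · change a ∈ part 1 at ha
    change b ∈ part 0 at hb
    change a * b ∈ part 1
    rw [← oddPart_of_mem ha, ← evenPart_of_mem hb, mem_part_one]
    simp [evenPart, oddPart, Matrix.fromBlocks_multiply]
  · change a ∈ part 1 at ha
    change b ∈ part 1 at hb
    change a * b ∈ part 0
    rw [← oddPart_of_mem ha, ← oddPart_of_mem hb, mem_part_zero]
    simp [oddPart, Matrix.fromBlocks_multiply]

/-- The supercommutator, i.e. the bilinear extension of `a b - (-1)^{ij} b a` for `a` of parity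
`i` and `b` of parity `j`. -/
def superBracket : SuperMatrix m n →ₗ[ℂ] SuperMatrix m n →ₗ[ℂ] SuperMatrix m n :=
  LinearMap.mk₂ ℂ
    (fun a b => a * b - (b * evenPart a + evenPart b * oddPart a - oddPart b * oddPart a))
    (fun a a' b => by simp only [map_add]; noncomm_ring)
    (fun c a b => by simp only [map_smul, Matrix.smul_mul, Matrix.mul_smul, smul_sub, smul_add])
    (fun a b b' => by simp only [map_add]; noncomm_ring)
    (fun c a b => by simp only [map_smul, Matrix.smul_mul, Matrix.mul_smul, smul_sub, smul_add])

theorem superBracket_of_mem {i j : ZMod 2} {a b : SuperMatrix m n}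
    (ha : a ∈ part i) (hb : b ∈ part j) :
    superBracket a b = a * b - koszulSign i j • (b * a) := by
  change a * b - (b * evenPart a + evenPart b * oddPart a - oddPart b * oddPart a) = _
  fin_cases i
  · change a ∈ part 0 at ha
    have hs : koszulSign 0 j = 1 := by simp [koszulSign]
    change _ = a * b - koszulSign 0 j • (b * a)
    rw [evenPart_of_mem ha, mem_part_zero.1 ha, hs]
    simp
  · change a ∈ part 1 at ha
    rw [oddPart_of_mem ha, mem_part_one.1 ha]
    fin_cases j
    · change b ∈ part 0 at hb
      have hs : koszulSign 1 0 = 1 := by simp [koszulSign]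
      change _ = a * b - koszulSign 1 0 • (b * a)
      rw [evenPart_of_mem hb, mem_part_zero.1 hb, hs]
      simp
    · change b ∈ part 1 at hb
      have hs : koszulSign 1 1 = -1 := by
        simp only [koszulSign, mul_one, ZMod.val_one, pow_one]
      change _ = a * b - koszulSign 1 1 • (b * a)
      rw [oddPart_of_mem hb, mem_part_one.1 hb, hs]
      simp

theorem superBracket_mem {i j : ZMod 2} {a b : SuperMatrix m n}
    (ha : a ∈ part i) (hb : b ∈ part j) : superBracket a b ∈ part (i + j) := by
  rw [superBracket_of_mem ha hb]
  exact Submodule.sub_mem _ (mul_mem ha hb) (Submodule.smul_mem _ _ (add_comm j i ▸ mul_mem hb ha))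

theorem koszulSign_comm (i j : ZMod 2) : koszulSign i j = koszulSign j i := by
  simp [koszulSign, mul_comm]

theorem koszulSign_sq (i j : ZMod 2) : koszulSign i j * koszulSign i j = 1 := by
  rw [koszulSign, ← mul_pow]; simp

theorem koszulSign_add (i j k : ZMod 2) :
    koszulSign i (j + k) = koszulSign i j * koszulSign i k := by
  have h : ∀ i j k : ZMod 2,
      ((-1 : ℤ) ^ (i * (j + k)).val) = (-1) ^ (i * j).val * (-1) ^ (i * k).val := by decide
  simpa [koszulSign] using congrArg (Int.cast : ℤ → ℂ) (h i j k)

/-- The general linear Lie superalgebra `gl(m|n)`. -/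
def gl (m n : ℕ) : LieSuperalgebra (SuperMatrix m n) where
  part := part
  isCompl := by
    constructor
    · rw [Submodule.disjoint_def]
      intro a h0 h1
      rw [← even_add_odd a, mem_part_zero.1 h0, mem_part_one.1 h1, add_zero]
    · rw [codisjoint_iff, Submodule.eq_top_iff']
      intro a
      exact Submodule.mem_sup.2 ⟨_, evenPart_mem a, _, oddPart_mem a, even_add_odd a⟩
  bracket := superBracket
  bracket_mem := superBracket_mem
  skew := by
    intro i j a b ha hb
    rw [superBracket_of_mem ha hb, superBracket_of_mem hb ha, koszulSign_comm j i, smul_sub,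
      smul_smul, koszulSign_sq, one_smul, neg_sub]
  jacobi := by
    intro i j k a b c ha hb hc
    rw [superBracket_of_mem ha (superBracket_mem hb hc),
      superBracket_of_mem (superBracket_mem ha hb) hc,
      superBracket_of_mem hb (superBracket_mem ha hc),
      superBracket_of_mem hb hc, superBracket_of_mem ha hb, superBracket_of_mem ha hc,
      koszulSign_comm (i + j) k, koszulSign_add, koszulSign_add, koszulSign_add,
      koszulSign_comm k i, koszulSign_comm k j, koszulSign_comm j i]
    have h := koszulSign_sq i j
    simp only [mul_sub, sub_mul, smul_sub, Matrix.mul_smul, Matrix.smul_mul, smul_smul,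
      ← Matrix.mul_assoc]
    have h2 : koszulSign i j * (koszulSign i j * koszulSign j k) = koszulSign j k := by
      rw [← mul_assoc, h, one_mul]
    have h3 : koszulSign i j * (koszulSign i j * koszulSign j k * koszulSign i k) =
      koszulSign i k * koszulSign j k := by
      rw [← mul_assoc, ← mul_assoc, h, one_mul, mul_comm]
    simp only [h2, h3]
    match_scalars <;> ring

/-- The supertrace: the trace of the upper diagonal block minus that of the lower one. -/
def supertrace : SuperMatrix m n →ₗ[ℂ] ℂ where
  toFun a := a.toBlocks₁₁.trace - a.toBlocks₂₂.trace
  map_add' a b := by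
    simp only [Matrix.trace, Matrix.diag, Matrix.toBlocks₁₁, Matrix.toBlocks₂₂, Matrix.of_apply,
      Matrix.add_apply, Finset.sum_add_distrib]
    ring
  map_smul' c a := by
    simp only [Matrix.trace, Matrix.diag, Matrix.toBlocks₁₁, Matrix.toBlocks₂₂, Matrix.of_apply,
      Matrix.smul_apply, smul_eq_mul, ← Finset.mul_sum, RingHom.id_apply]
    ring

theorem supertrace_of_odd {a : SuperMatrix m n} (h : a ∈ part 1) : supertrace a = 0 := by
  rw [← oddPart_of_mem h]
  simp [supertrace, oddPart]

theorem supertrace_superBracket (a b : SuperMatrix m n) : supertrace (superBracket a b) = 0 := by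
  have hab : superBracket a b = superBracket (evenPart a) (evenPart b) +
      superBracket (evenPart a) (oddPart b) + superBracket (oddPart a) (evenPart b) +
      superBracket (oddPart a) (oddPart b) := by
    conv_lhs => rw [← even_add_odd a, ← even_add_odd b]
    simp only [map_add, LinearMap.add_apply]
    abel
  have h01 : supertrace (superBracket (evenPart a) (oddPart b)) = 0 :=
    supertrace_of_odd (superBracket_mem (evenPart_mem a) (oddPart_mem b))
  have h10 : supertrace (superBracket (oddPart a) (evenPart b)) = 0 :=
    supertrace_of_odd (superBracket_mem (oddPart_mem a) (evenPart_mem b))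
  have h00 : supertrace (superBracket (evenPart a) (evenPart b)) = 0 := by
    have hs : koszulSign 0 0 = 1 := by simp [koszulSign]
    rw [superBracket_of_mem (evenPart_mem a) (evenPart_mem b), hs, one_smul, map_sub]
    simp only [supertrace, evenPart, LinearMap.coe_mk, AddHom.coe_mk, Matrix.fromBlocks_multiply,
      Matrix.toBlocks_fromBlocks₁₁, Matrix.toBlocks_fromBlocks₂₂, Matrix.mul_zero, add_zero,
      zero_add]
    rw [Matrix.trace_mul_comm a.toBlocks₁₁, Matrix.trace_mul_comm a.toBlocks₂₂]
    ring
  have h11 : supertrace (superBracket (oddPart a) (oddPart b)) = 0 := by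
    have hs : koszulSign 1 1 = -1 := by
      simp only [koszulSign, mul_one, ZMod.val_one, pow_one]
    rw [superBracket_of_mem (oddPart_mem a) (oddPart_mem b), hs, neg_smul, one_smul,
      sub_neg_eq_add, map_add]
    simp only [supertrace, oddPart, LinearMap.coe_mk, AddHom.coe_mk, Matrix.fromBlocks_multiply,
      Matrix.toBlocks_fromBlocks₁₁, Matrix.toBlocks_fromBlocks₂₂, Matrix.mul_zero, add_zero,
      zero_add]
    rw [Matrix.trace_mul_comm a.toBlocks₁₂, Matrix.trace_mul_comm a.toBlocks₂₁]
    ring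
  rw [hab, map_add, map_add, map_add, h00, h01, h10, h11]
  simp

/-- The underlying space of `sl(m|n)`. -/
def slSpace (m n : ℕ) : Submodule ℂ (SuperMatrix m n) := LinearMap.ker supertrace

/-- The special linear Lie superalgebra `sl(m|n)`. -/
def sl (m n : ℕ) : LieSuperalgebra (slSpace m n) :=
  (gl m n).sub (slSpace m n)
    (by
      intro a ha
      have h1 : supertrace (oddPart a) = 0 := supertrace_of_odd (oddPart_mem a)
      have h0 : supertrace (evenPart a) = 0 := by
        have h : supertrace a = 0 := ha
        rwa [← even_add_odd a, map_add, h1, add_zero] at h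
      exact ⟨_, ⟨h0, evenPart_mem a⟩, _, ⟨h1, oddPart_mem a⟩, (even_add_odd a).symm⟩)
    (fun a _ b _ => supertrace_superBracket a b)

/-- The line of scalar matrices in `sl(m|m)`. -/
def scalars (m : ℕ) : Submodule ℂ (slSpace m m) :=
  (Submodule.span ℂ {(1 : SuperMatrix m m)}).comap (slSpace m m).subtype

theorem one_mem_part : (1 : SuperMatrix m n) ∈ part 0 := by
  rw [mem_part_zero]
  ext (i | i) (j | j) <;> simp [oddPart, Matrix.toBlocks₁₂, Matrix.toBlocks₂₁]

theorem superBracket_one (a : SuperMatrix m n) :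
    superBracket a 1 = 0 ∧ superBracket 1 a = 0 := by
  have h1 := evenPart_of_mem (one_mem_part (m := m) (n := n))
  have h2 := mem_part_zero.1 (one_mem_part (m := m) (n := n))
  constructor
  · change a * 1 - (1 * evenPart a + evenPart 1 * oddPart a - oddPart 1 * oddPart a) = 0
    rw [h1, h2, mul_one, one_mul, one_mul, zero_mul, sub_zero, even_add_odd, sub_self]
  · change 1 * a - (a * evenPart 1 + evenPart a * oddPart 1 - oddPart a * oddPart 1) = 0
    rw [h1, h2]
    simp

/-- The projective special linear Lie superalgebra `psl(m|m) = sl(m|m) / ℂ Id`. -/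
def psl (m : ℕ) : LieSuperalgebra (slSpace m m ⧸ scalars m) :=
  (sl m m).quot (scalars m)
    (by
      intro a ha
      refine ⟨a, ⟨ha, ?_⟩, 0, Submodule.zero_mem _, (add_zero a).symm⟩
      obtain ⟨c, hc⟩ := Submodule.mem_span_singleton.1 (Submodule.mem_comap.1 ha)
      change (slSpace m m).subtype a ∈ part 0
      rw [← hc]
      exact Submodule.smul_mem _ _ one_mem_part)
    (by
      intro a b hb
      obtain ⟨c, hc⟩ := Submodule.mem_span_singleton.1 (Submodule.mem_comap.1 hb)
      have h : (sl m m).bracket a b = 0 := by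
        apply Subtype.ext
        change superBracket (a : SuperMatrix m m) ((slSpace m m).subtype b) = 0
        rw [← hc, map_smul, (superBracket_one _).1, smul_zero]
      rw [h]
      exact Submodule.zero_mem _)
    (by
      intro a ha b
      obtain ⟨c, hc⟩ := Submodule.mem_span_singleton.1 (Submodule.mem_comap.1 ha)
      have h : (sl m m).bracket a b = 0 := by
        apply Subtype.ext
        change superBracket ((slSpace m m).subtype a) (b : SuperMatrix m m) = 0
        rw [← hc, map_smul, LinearMap.smul_apply, (superBracket_one _).2, smul_zero]
      rw [h]
      exact Submodule.zero_mem _)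

end SuperMatrix

/-- The matrices `e, x, f` make `ℂ^N` the direct sum of the irreducible `sl₂`-modules
`V(p - 1)`, `p` running over the multiset `parts`. Here `V(d - 1)`, of dimension `d` and highest
weight `d - 1` (for `2x`), has the standard basis `v_0, …, v_{d-1}` with
`x v_j = ((d-1)/2 - j) v_j`, `f v_j = v_{j+1}` (`v_d = 0`), `e v_j = (j (d-j) / 2) v_{j-1}`. -/
def DecomposesAs {N : ℕ} (e x f : Matrix (Fin N) (Fin N) ℂ) (parts : Multiset ℕ) : Prop :=
  ∃ (r : ℕ) (d : Fin r → ℕ) (b : Module.Basis (Σ i, Fin (d i)) ℂ (Fin N → ℂ)),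
    Multiset.map d Finset.univ.val = parts ∧
    ∀ (i : Fin r) (j : Fin (d i)),
      x.mulVec (b ⟨i, j⟩) = (((d i : ℂ) - 1) / 2 - (j : ℕ)) • b ⟨i, j⟩ ∧
      f.mulVec (b ⟨i, j⟩) = (if h : (j : ℕ) + 1 < d i then b ⟨i, ⟨j + 1, h⟩⟩ else 0) ∧
      e.mulVec (b ⟨i, j⟩) = ((((j : ℕ) : ℂ) * ((d i : ℂ) - (j : ℕ))) / 2) •
        b ⟨i, ⟨(j : ℕ) - 1, lt_of_le_of_lt (Nat.sub_le _ _) j.isLt⟩⟩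

/-- The even triple `(e, x, f)` of supermatrices, hence `f`, is encoded by the pair of partitions
`(α, β)`: under it, `ℂ^m = ⨁ V(p - 1)` over the parts `p` of `α` and `ℂ^n = ⨁ V(p - 1)` over the
parts `p` of `β`. -/
def IsEncodedBy {m n : ℕ} (e x f : SuperMatrix m n) (α : m.Partition) (β : n.Partition) : Prop :=
  DecomposesAs e.toBlocks₁₁ x.toBlocks₁₁ f.toBlocks₁₁ α.parts ∧
    DecomposesAs e.toBlocks₂₂ x.toBlocks₂₂ f.toBlocks₂₂ β.parts

/-- A triple in `psl(m|m)` is encoded by the pair `(α, β)` if it lifts to an `sl₂`-triple in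
the even part of `sl(m|m)` that is. -/
def IsEncodedByPsl {m : ℕ} (e x f : SuperMatrix.slSpace m m ⧸ SuperMatrix.scalars m)
    (α β : m.Partition) : Prop :=
  ∃ e' x' f' : SuperMatrix.slSpace m m,
    (SuperMatrix.scalars m).mkQ e' = e ∧ (SuperMatrix.scalars m).mkQ x' = x ∧
    (SuperMatrix.scalars m).mkQ f' = f ∧ (SuperMatrix.sl m m).IsEvenSl2Triple e' x' f' ∧
    IsEncodedBy e'.1 x'.1 f'.1 α β

/-- The number of distinct parts greater than `1` occurring in `α` or `β`. -/
def numBigParts {m n : ℕ} (α : m.Partition) (β : n.Partition) : ℕ :=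
  ((α.parts.toFinset ∪ β.parts.toFinset).filter (fun p => 1 < p)).card

/-- The pair `(α, β)` is `(q^l, 1^r | 0)`, `(0 | q^l, 1^r)`, `(q^l | 1^n)` or `(1^m | q^l)` with
`q ≥ 2` and `l ≥ 1`. -/
def IsListedPair {m n : ℕ} (α : m.Partition) (β : n.Partition) : Prop :=
  ∃ q l : ℕ, 2 ≤ q ∧ 1 ≤ l ∧
    ((∃ r : ℕ, m = q * l + r ∧ n = 0 ∧
        α.parts = Multiset.replicate l q + Multiset.replicate r 1 ∧ β.parts = 0) ∨
      (∃ r : ℕ, m = 0 ∧ n = q * l + r ∧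
        α.parts = 0 ∧ β.parts = Multiset.replicate l q + Multiset.replicate r 1) ∨
      (m = q * l ∧ α.parts = Multiset.replicate l q ∧ β.parts = Multiset.replicate n 1) ∨
      (n = q * l ∧ α.parts = Multiset.replicate m 1 ∧ β.parts = Multiset.replicate l q))

end

/-! The multiplicity is the dimension of the space `H` of vectors killed by the centralizer and by
`e` and of weight `1` for `x`. Each summand isomorphic to (trivial) ⊗ (adjoint) meets `H` in a line.
Conversely, the projections of a vector of `H` to the summands stay in `H`, and an irreducible
summand that meets `H` is generated by a vector `v` of `H`, so it is spanned by `v`, `f v`, `f² v`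
(`IsEvenSl2Triple.ncard_isTrivAdj`).

To compute `H`, write `ℂ^m ⊕ ℂ^n = ⨁ V(d j - 1)`, each summand with a sign `±1` for its parity. An
isomorphism between two distinct summands of equal dimension is a supertraceless matrix that
centralizes the triple. As the centralizer is even, the two summands have the same sign
(`IsStandardForm.sign_eq`), so `α` and `β` share no part. For `M` in `H`, commuting with
supertraceless matrices that are scalar on each summand makes `M` block diagonal. Weight `1` and
commutation with `e` make each block a multiple of `e`, and commutation with the isomorphisms makes
the multiple depend only on the dimension (`exists_eq_of_mem_highestWeight`). Hence `H` has one
dimension for each distinct `d j > 1`; `e` vanishes on the one-dimensional summands.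

Decompositions exist by a unitarity argument. There is an inner product on `⨁ V(d j - 1)` with `f`
adjoint to `e` and `x` self-adjoint, so the acting operators are closed under adjoints and
orthogonal complements of stable subspaces are stable.

For `psl(m|m)`, the bracket with an even element is a commutator, so it has trace zero and vanishes
as soon as it is scalar. Centralizer and `H` are therefore the images of those of `sl(m|m)`, and `H`
maps injectively. The list of pairs is combinatorics: a single part size `q > 1` occurs, and `α`,
`β` are disjoint. -/

noncomputable section

/-! ### Complete reducibility for sets of operators -/

section StableSubspaces

variable {V : Type*} [AddCommGroup V] [Module ℂ V]

/-- The subspace `W` is mapped into itself by all operators in `𝒮`. -/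
def StableUnder (𝒮 : Set (Module.End ℂ V)) (W : Submodule ℂ V) : Prop :=
  ∀ T ∈ 𝒮, ∀ w ∈ W, T w ∈ W

/-- `W` is a minimal nonzero stable subspace. -/
def IsMinimalStable (𝒮 : Set (Module.End ℂ V)) (W : Submodule ℂ V) : Prop :=
  StableUnder 𝒮 W ∧ W ≠ ⊥ ∧ ∀ U ≤ W, StableUnder 𝒮 U → U = ⊥ ∨ U = W

/-- Every stable subspace has a stable complement. -/
def HasStableComplements (𝒮 : Set (Module.End ℂ V)) : Prop :=
  ∀ W, StableUnder 𝒮 W → ∃ W', StableUnder 𝒮 W' ∧ IsCompl W W'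

variable {𝒮 : Set (Module.End ℂ V)}

theorem StableUnder.inf {W W' : Submodule ℂ V} (h : StableUnder 𝒮 W) (h' : StableUnder 𝒮 W') :
    StableUnder 𝒮 (W ⊓ W') :=
  fun T hT w hw => ⟨h T hT w hw.1, h' T hT w hw.2⟩

theorem exists_isMinimalStable_le [FiniteDimensional ℂ V] (K : Submodule ℂ V)
    (hK : StableUnder 𝒮 K) (hK0 : K ≠ ⊥) : ∃ W ≤ K, IsMinimalStable 𝒮 W := by
  induction h : Module.finrank ℂ K using Nat.strong_induction_on generalizing K with
  | _ n ih =>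
    by_cases hmin : ∀ U ≤ K, StableUnder 𝒮 U → U = ⊥ ∨ U = K
    · exact ⟨K, le_rfl, hK, hK0, hmin⟩
    · push Not at hmin
      obtain ⟨U, hUK, hU, hU0, hUne⟩ := hmin
      obtain ⟨W, hWU, hW⟩ := ih _ (h ▸ Submodule.finrank_lt_finrank_of_lt (lt_of_le_of_ne hUK hUne))
        U hU hU0 rfl
      exact ⟨W, hWU.trans hUK, hW⟩

/-- A minimal stable `W ≤ K` is split off using a stable complement `C` of `W` in the whole space:
by the modular law `C ⊓ K` complements `W` inside `K`, and it has smaller dimension. -/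
theorem HasStableComplements.exists_finset [FiniteDimensional ℂ V] (h : HasStableComplements 𝒮)
    (K : Submodule ℂ V) (hK : StableUnder 𝒮 K) :
    ∃ s : Finset (Submodule ℂ V), (∀ W ∈ s, IsMinimalStable 𝒮 W) ∧ s.SupIndep id ∧
      s.sup id = K := by
  classical
  induction hn : Module.finrank ℂ K using Nat.strong_induction_on generalizing K with
  | _ n ih =>
    by_cases hK0 : K = ⊥
    · exact ⟨∅, by simp, Finset.supIndep_empty _, by simp [hK0]⟩
    · obtain ⟨W, hWK, hW⟩ := exists_isMinimalStable_le K hK hK0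
      obtain ⟨C, hC, hWC⟩ := h W hW.1
      have hd : Disjoint W (C ⊓ K) := hWC.disjoint.mono_right inf_le_left
      have hs : W ⊔ C ⊓ K = K := by
        rw [← sup_inf_assoc_of_le C hWK, hWC.sup_eq_top, top_inf_eq]
      have hlt : C ⊓ K < K := by
        refine lt_of_le_of_ne inf_le_right fun he => hW.2.1 ?_
        rw [he] at hd
        exact disjoint_self.1 (hd.mono_right hWK)
      obtain ⟨s, hs1, hs2, hs3⟩ := ih _ (hn ▸ Submodule.finrank_lt_finrank_of_lt hlt)
        (C ⊓ K) (hC.inf hK) rfl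
      refine ⟨insert W s, ?_, hs2.insert (by simpa [hs3] using hd), ?_⟩
      · intro U hU
        rcases Finset.mem_insert.1 hU with rfl | hU
        exacts [hW, hs1 U hU]
      · rw [Finset.sup_insert, hs3]
        exact hs

theorem HasStableComplements.exists_isInternal [FiniteDimensional ℂ V]
    (h : HasStableComplements 𝒮) : ∃ (r : ℕ) (ρ : Fin r → Submodule ℂ V),
      DirectSum.IsInternal ρ ∧ ∀ i, IsMinimalStable 𝒮 (ρ i) := by
  classical
  obtain ⟨s, hs1, hs2, hs3⟩ := h.exists_finset ⊤ (fun _ _ _ _ => Submodule.mem_top)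
  refine ⟨s.card, fun i => (s.equivFin.symm i : Submodule ℂ V), ?_, fun i => hs1 _ (Subtype.coe_prop _)⟩
  apply DirectSum.isInternal_submodule_of_iSupIndep_of_iSup_eq_top
  · have := iSupIndep_comp_coe_iff_supIndep.2 hs2
    exact this.comp s.equivFin.symm.injective
  · rw [← hs3, Finset.sup_eq_iSup, Equiv.iSup_comp s.equivFin.symm (g := fun W : s => (W : Submodule ℂ V)),
      iSup_subtype]
    rfl

/-- A set of operators that is closed under adjoints for some inner product has stable
complements. -/
theorem HasStableComplements.of_adjoint [FiniteDimensional ℂ V] (c : InnerProductSpace.Core ℂ V)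
    (h : ∀ T ∈ 𝒮, ∃ T' ∈ 𝒮, ∀ a b, c.inner (T' a) b = c.inner a (T b)) :
    HasStableComplements 𝒮 := by
  intro W hW
  let _ : NormedAddCommGroup V := c.toNormedAddCommGroup
  let _ : InnerProductSpace ℂ V := InnerProductSpace.ofCore c.toCore
  refine ⟨Wᗮ, fun T hT w hw => ?_, W.isCompl_orthogonal⟩
  obtain ⟨T', hT', hadj⟩ := h T hT
  rw [Submodule.mem_orthogonal] at hw ⊢
  intro u hu
  exact (hadj u w).symm.trans (hw _ (hW T' hT' u hu))

/-- Stable complements pass to quotients on which every operator is induced by an operator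
upstairs, and conversely. -/
theorem HasStableComplements.quotient {I : Submodule ℂ V} {𝒯 : Set (Module.End ℂ (V ⧸ I))}
    (h : HasStableComplements 𝒮)
    (hST : ∀ T ∈ 𝒮, ∃ T' ∈ 𝒯, ∀ v, T' (I.mkQ v) = I.mkQ (T v))
    (hTS : ∀ T' ∈ 𝒯, ∃ T ∈ 𝒮, ∀ v, T' (I.mkQ v) = I.mkQ (T v)) :
    HasStableComplements 𝒯 := by
  intro W hW
  -- The complement is taken to the preimage of `W`, which contains `I`, so its image downstairs
  -- still meets `W` trivially.
  obtain ⟨C, hC, hWC⟩ := h (W.comap I.mkQ) (by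
    intro T hT w hw
    obtain ⟨T', hT', he⟩ := hST T hT
    rw [Submodule.mem_comap, ← he]
    exact hW T' hT' _ hw)
  refine ⟨C.map I.mkQ, ?_, ?_, ?_⟩
  · rintro T' hT' _ ⟨w, hw, rfl⟩
    obtain ⟨T, hT, he⟩ := hTS T' hT'
    rw [he]
    exact ⟨_, hC T hT w hw, rfl⟩
  · rw [Submodule.disjoint_def]
    rintro _ hw ⟨c, hc, rfl⟩
    rw [Submodule.disjoint_def.1 hWC.disjoint c hw hc, map_zero]
  · rw [codisjoint_iff, ← Submodule.map_comap_eq_of_surjective I.mkQ_surjective W,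
      ← Submodule.map_sup, hWC.sup_eq_top, Submodule.map_top, Submodule.range_mkQ]

end StableSubspaces

/-! ### Multiplicity as the dimension of a space of highest weight vectors -/

namespace LieSuperalgebra

variable {V : Type*} [AddCommGroup V] [Module ℂ V]

/-- All signs are trivial when `a` and `b` are even, so the identity extends by linearity to a `c`
that is not homogeneous. -/
theorem jacobi_even (A : LieSuperalgebra V) {a b : V} (ha : a ∈ A.part 0) (hb : b ∈ A.part 0)
    (c : V) : A.bracket a (A.bracket b c) =
      A.bracket (A.bracket a b) c + A.bracket b (A.bracket a c) := by
  have hc : c ∈ A.part 0 ⊔ A.part 1 := by rw [A.isCompl.sup_eq_top]; trivial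
  obtain ⟨c₀, h₀, c₁, h₁, rfl⟩ := Submodule.mem_sup.1 hc
  have e0 := A.jacobi ha hb h₀
  have e1 := A.jacobi ha hb h₁
  have hs : koszulSign 0 0 = 1 := by simp [koszulSign]
  rw [hs, one_smul] at e0 e1
  simp only [map_add, e0, e1]
  abel

theorem skew_even (A : LieSuperalgebra V) {a b : V} (ha : a ∈ A.part 0) (hb : b ∈ A.part 0) :
    A.bracket a b = -A.bracket b a := by
  have hs : koszulSign 0 0 = 1 := by simp [koszulSign]
  simpa [hs] using A.skew ha hb

/-- The operators through which the centralizer of the triple and the triple act. -/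
def actingOperators (A : LieSuperalgebra V) (e x f : V) : Set (Module.End ℂ V) :=
  A.bracket '' (A.natural e x f) ∪ {A.bracket e, A.bracket x, A.bracket f}

theorem isStable_iff (A : LieSuperalgebra V) (e x f : V) (W : Submodule ℂ V) :
    A.IsStable e x f W ↔ StableUnder (A.actingOperators e x f) W := by
  constructor
  · rintro h T (⟨z, hz, rfl⟩ | rfl | rfl | rfl) w hw
    exacts [(h w hw).1 z hz, (h w hw).2.1, (h w hw).2.2.1, (h w hw).2.2.2]
  · intro h w hw
    exact ⟨fun z hz => h _ (Or.inl ⟨z, hz, rfl⟩) w hw, h _ (Or.inr (by simp)) w hw,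
      h _ (Or.inr (by simp)) w hw, h _ (Or.inr (by simp)) w hw⟩

theorem isIrred_iff (A : LieSuperalgebra V) (e x f : V) (W : Submodule ℂ V) :
    A.IsIrred e x f W ↔ IsMinimalStable (A.actingOperators e x f) W := by
  simp only [IsIrred, IsMinimalStable, isStable_iff]

theorem exists_isDecomposition [FiniteDimensional ℂ V] (A : LieSuperalgebra V) (e x f : V)
    (h : HasStableComplements (A.actingOperators e x f)) :
    ∃ (r : ℕ) (ρ : Fin r → Submodule ℂ V), A.IsDecomposition e x f ρ := by
  obtain ⟨r, ρ, h1, h2⟩ := h.exists_isInternal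
  exact ⟨r, ρ, h1, fun i => (A.isIrred_iff e x f _).2 (h2 i)⟩

/-- The vectors killed by the centralizer of the triple and by `e`, of weight `1` for `x`. -/
def highestWeightVectors (A : LieSuperalgebra V) (e x f : V) : Submodule ℂ V where
  carrier := {v | (∀ z ∈ A.natural e x f, A.bracket z v = 0) ∧ A.bracket e v = 0 ∧
    A.bracket x v = v}
  add_mem' := by
    rintro a b ⟨h1, h2, h3⟩ ⟨k1, k2, k3⟩
    exact ⟨fun z hz => by rw [map_add, h1 z hz, k1 z hz, add_zero], by rw [map_add, h2, k2, add_zero],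
      by rw [map_add, h3, k3]⟩
  zero_mem' := by simp
  smul_mem' := by
    rintro c a ⟨h1, h2, h3⟩
    exact ⟨fun z hz => by rw [map_smul, h1 z hz, smul_zero], by rw [map_smul, h2, smul_zero],
      by rw [map_smul, h3]⟩

variable {A : LieSuperalgebra V} {e x f : V}

section

attribute [local instance] LieRing.ofAssociativeRing

/-- A primitive vector of weight `2` for the standard `sl₂` generates a module of dimension `3` in
finite dimension. -/
theorem IsEvenSl2Triple.bracket_f_cubed [FiniteDimensional ℂ V] (ht : A.IsEvenSl2Triple e x f)
    {v : V} (hev : A.bracket e v = 0) (hxv : A.bracket x v = v) :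
    A.bracket f (A.bracket f (A.bracket f v)) = 0 := by
  by_cases hv : v = 0
  · simp [hv]
  have hx0 : A.bracket x ≠ 0 := fun h => hv (by rw [← hxv, h, LinearMap.zero_apply])
  -- Rescaling `x` and `f` by `2` turns the normalization `[x, e] = e`, `[e, f] = x` into the
  -- standard `[h, e] = 2e`, `[e, f] = h`.
  have t : IsSl2Triple (L := Module.End ℂ V) ((2 : ℂ) • A.bracket x) (A.bracket e)
      ((2 : ℂ) • A.bracket f) := by
    refine ⟨smul_ne_zero two_ne_zero hx0, ?_, ?_, ?_⟩ <;> ext w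
    · have := A.jacobi_even ht.e_even ht.f_even w
      rw [ht.e_f] at this
      simp [Ring.lie_def, this, smul_add]
    · have := A.jacobi_even ht.x_even ht.e_even w
      rw [ht.x_e] at this
      simp [Ring.lie_def, this, two_smul]
      abel
    · have := A.jacobi_even ht.x_even ht.f_even w
      rw [ht.x_f] at this
      simp [Ring.lie_def, this, smul_add, two_smul]
      abel
  have P : t.HasPrimitiveVectorWith v (2 : ℂ) :=
    ⟨hv, by simp [hxv], by simpa using hev⟩
  have := P.pow_toEnd_f_eq_zero_of_eq_nat (n := 2) (by norm_num)
  simpa [pow_succ] using this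

end

/-- The span of `v`, `f v`, `f² v` is nonzero and stable, hence all of `W`. The centralizer kills it
because it commutes with `f`. -/
theorem IsEvenSl2Triple.isTrivAdj_of_irred [FiniteDimensional ℂ V] (ht : A.IsEvenSl2Triple e x f)
    (hnat : A.natural e x f ≤ A.part 0) {W : Submodule ℂ V} (hW : A.IsIrred e x f W) {v : V}
    (hvW : v ∈ W) (hv : v ∈ A.highestWeightVectors e x f) (hv0 : v ≠ 0) :
    A.IsTrivAdj e x f W := by
  obtain ⟨hz, he, hx⟩ := hv
  have jef := A.jacobi_even ht.e_even ht.f_even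
  have jxf := A.jacobi_even ht.x_even ht.f_even
  rw [ht.e_f] at jef
  rw [ht.x_f] at jxf
  have hzf : ∀ z ∈ A.natural e x f, ∀ w, A.bracket z w = 0 → A.bracket z (A.bracket f w) = 0 := by
    intro z hzn w hw
    have hzf : A.bracket z f = 0 := by
      rw [A.skew_even (hnat hzn) ht.f_even, LinearMap.mem_ker.1 hzn.2, neg_zero]
    rw [A.jacobi_even (hnat hzn) ht.f_even, hw, hzf]
    simp
  have e1 : A.bracket e (A.bracket f v) = v := by rw [jef, he, hx]; simp
  have x1 : A.bracket x (A.bracket f v) = 0 := by rw [jxf, hx]; simp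
  have e2 : A.bracket e (A.bracket f (A.bracket f v)) = A.bracket f v := by
    rw [jef, e1, x1]; simp
  have x2 : A.bracket x (A.bracket f (A.bracket f v)) = -A.bracket f (A.bracket f v) := by
    rw [jxf, x1]; simp
  have f2 := ht.bracket_f_cubed he hx
  have hfv0 : A.bracket f v ≠ 0 := fun h => hv0 (by rw [← e1, h, map_zero])
  have hffv0 : A.bracket f (A.bracket f v) ≠ 0 := fun h => hfv0 (by rw [← e2, h, map_zero])
  -- The signs are those of the adjoint representation: `[f, e] = -x` and `[f, x] = f`.
  let u : Fin 3 → V := ![v, -A.bracket f v, -A.bracket f (A.bracket f v)]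
  have hzu : ∀ z ∈ A.natural e x f, ∀ j, A.bracket z (u j) = 0 := by
    intro z hzn j
    have h1 := hzf z hzn v (hz z hzn)
    fin_cases j
    · exact hz z hzn
    · simp [u, h1]
    · simp [u, hzf z hzn _ h1]
  have heu : A.bracket e (u 0) = 0 ∧ A.bracket e (u 1) = -u 0 ∧ A.bracket e (u 2) = u 1 := by
    simp [u, he, e1, e2]
  have hxu : A.bracket x (u 0) = u 0 ∧ A.bracket x (u 1) = 0 ∧ A.bracket x (u 2) = -u 2 := by
    simp [u, hx, x1, x2]
  have hfu : A.bracket f (u 0) = -u 1 ∧ A.bracket f (u 1) = u 2 ∧ A.bracket f (u 2) = 0 := by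
    simp [u, f2]
  -- Eigenvectors of `x` for the distinct eigenvalues `1, 0, -1`.
  have hli : LinearIndependent ℂ u := by
    refine Module.End.eigenvectors_linearIndependent' (A.bracket x) ![(1 : ℂ), 0, -1] ?_ u ?_
    · intro i j hij
      fin_cases i <;> fin_cases j <;> simp at hij <;> first | rfl | norm_num at hij
    · intro i
      rw [Module.End.hasEigenvector_iff, Module.End.mem_eigenspace_iff]
      fin_cases i
      · simpa [u] using ⟨hx, hv0⟩
      · simpa [u] using ⟨x1, hfv0⟩
      · exact ⟨by simp [u, x2], by simpa [u] using hffv0⟩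
  have huW : ∀ j, u j ∈ W := by
    have hf : ∀ w ∈ W, A.bracket f w ∈ W := fun w hw => (hW.1 w hw).2.2.2
    intro j
    fin_cases j
    · exact hvW
    · exact W.neg_mem (hf _ hvW)
    · exact W.neg_mem (hf _ (hf _ hvW))
  refine ⟨u, hli, ?_, hzu, heu, hxu, hfu⟩
  have hmem : ∀ j, u j ∈ Submodule.span ℂ (Set.range u) :=
    fun j => Submodule.subset_span (Set.mem_range_self j)
  have hcl : ∀ T : Module.End ℂ V, (∀ j, T (u j) ∈ Submodule.span ℂ (Set.range u)) →
      ∀ w ∈ Submodule.span ℂ (Set.range u), T w ∈ Submodule.span ℂ (Set.range u) := by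
    intro T hT w hw
    have : Submodule.span ℂ (Set.range u) ≤ (Submodule.span ℂ (Set.range u)).comap T := by
      rw [Submodule.span_le]
      rintro _ ⟨j, rfl⟩
      exact hT j
    exact this hw
  refine (hW.2.2 _ ?_ ?_).resolve_left fun h => hv0 ?_
  · rw [Submodule.span_le]
    rintro _ ⟨j, rfl⟩
    exact huW j
  · intro w hw
    refine ⟨fun z hzn => hcl _ (fun j => ?_) w hw, hcl _ (fun j => ?_) w hw,
      hcl _ (fun j => ?_) w hw, hcl _ (fun j => ?_) w hw⟩
    · rw [hzu z hzn]; exact Submodule.zero_mem _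
    · fin_cases j
      · exact heu.1 ▸ Submodule.zero_mem _
      · exact heu.2.1 ▸ Submodule.neg_mem _ (hmem 0)
      · exact heu.2.2 ▸ hmem 1
    · fin_cases j
      · exact hxu.1.symm ▸ hmem 0
      · exact hxu.2.1 ▸ Submodule.zero_mem _
      · exact hxu.2.2 ▸ Submodule.neg_mem _ (hmem 2)
    · fin_cases j
      · exact hfu.1 ▸ Submodule.neg_mem _ (hmem 1)
      · exact hfu.2.1 ▸ hmem 2
      · exact hfu.2.2 ▸ Submodule.zero_mem _
  · exact (Submodule.mem_bot ℂ).1 (h ▸ hmem 0)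

theorem IsTrivAdj.exists_highestWeight {W : Submodule ℂ V} (h : A.IsTrivAdj e x f W) :
    ∃ v ∈ W, v ∈ A.highestWeightVectors e x f ∧ v ≠ 0 ∧
      ∀ w ∈ W, w ∈ A.highestWeightVectors e x f → ∃ c : ℂ, c • v = w := by
  obtain ⟨u, hli, hspan, hz, he, hx, -⟩ := h
  have hmem : ∀ j, u j ∈ W := fun j => hspan ▸ Submodule.subset_span (Set.mem_range_self j)
  refine ⟨u 0, hmem 0, ⟨fun z hzn => hz z hzn 0, he.1, hx.1⟩, hli.ne_zero 0, ?_⟩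
  intro w hw hwH
  rw [← hspan] at hw
  obtain ⟨c, rfl⟩ := (Submodule.mem_span_range_iff_exists_fun ℂ).1 hw
  have h0 := hwH.2.2
  simp only [Fin.sum_univ_three, map_add, map_smul, hx.1, hx.2.1, hx.2.2] at h0
  -- For `w = ∑ c j • u j`, the relation `x w = w` reads `c 1 • u 1 + 2 c 2 • u 2 = 0`.
  have h1 := Fintype.linearIndependent_iff.1 hli ![0, c 1, 2 * c 2] (by
    rw [Fin.sum_univ_three, ← neg_eq_zero, ← sub_eq_zero.2 h0]
    simp
    module)
  have c1 : c 1 = 0 := by simpa using h1 1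
  have c2 : c 2 = 0 := by simpa using h1 2
  exact ⟨c 0, by simp [Fin.sum_univ_three, c1, c2]⟩

/-- One highest weight vector chosen in each (trivial) ⊗ (adjoint) summand gives a basis of the
space of highest weight vectors. -/
theorem IsEvenSl2Triple.ncard_isTrivAdj [FiniteDimensional ℂ V] (ht : A.IsEvenSl2Triple e x f)
    (hnat : A.natural e x f ≤ A.part 0) {r : ℕ} {ρ : Fin r → Submodule ℂ V}
    (hρ : A.IsDecomposition e x f ρ) :
    Set.ncard {i | A.IsTrivAdj e x f (ρ i)} =
      Module.finrank ℂ (A.highestWeightVectors e x f) := by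
  classical
  set T : Set (Fin r) := {i | A.IsTrivAdj e x f (ρ i)} with hT
  have hex : ∀ i : T, ∃ v ∈ ρ i, v ∈ A.highestWeightVectors e x f ∧ v ≠ 0 ∧
      ∀ w ∈ ρ i, w ∈ A.highestWeightVectors e x f → ∃ c : ℂ, c • v = w :=
    fun i => IsTrivAdj.exists_highestWeight i.2
  choose v hvρ hvH hv0 hvs using hex
  have hind := hρ.1.submodule_iSupIndep
  have hli : LinearIndependent ℂ v :=
    (hind.comp Subtype.val_injective).linearIndependent (fun i : T => ρ i) hvρ hv0
  have hspan : Submodule.span ℂ (Set.range v) = A.highestWeightVectors e x f := by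
    apply le_antisymm
    · rw [Submodule.span_le]
      rintro _ ⟨i, rfl⟩
      exact hvH i
    · intro w hw
      have htop : w ∈ ⨆ i, ρ i := by rw [hρ.1.submodule_iSup_eq_top]; trivial
      obtain ⟨w', hw', rfl⟩ := (Submodule.mem_iSup_iff_exists_finsupp ρ w).1 htop
      rw [Finsupp.sum_fintype _ _ (fun _ => rfl)] at hw ⊢
      have key := (iSupIndep_iff_finsetSum_eq_zero_imp_eq_zero ρ).1 hind Finset.univ
      -- The summands are stable and independent, so each linear condition on the sum holds
      -- componentwise.
      have hcomp : ∀ i, w' i ∈ A.highestWeightVectors e x f := by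
        intro i
        refine ⟨fun z hz => ?_, ?_, ?_⟩
        · exact key (fun i => A.bracket z (w' i)) (fun i _ => ((hρ.2 i).1 _ (hw' i)).1 z hz)
            (by rw [← map_sum]; exact hw.1 z hz) i (Finset.mem_univ i)
        · exact key (fun i => A.bracket e (w' i)) (fun i _ => ((hρ.2 i).1 _ (hw' i)).2.1)
            (by rw [← map_sum]; exact hw.2.1) i (Finset.mem_univ i)
        · exact sub_eq_zero.1 (key (fun i => A.bracket x (w' i) - w' i)
            (fun i _ => (ρ i).sub_mem ((hρ.2 i).1 _ (hw' i)).2.2.1 (hw' i))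
            (by rw [Finset.sum_sub_distrib, ← map_sum, sub_eq_zero]; exact hw.2.2) i
            (Finset.mem_univ i))
      refine Submodule.sum_mem _ fun i _ => ?_
      by_cases hi : w' i = 0
      · rw [hi]; exact Submodule.zero_mem _
      · have hiT : i ∈ T := ht.isTrivAdj_of_irred hnat (hρ.2 i) (hw' i) (hcomp i) hi
        obtain ⟨c, hc⟩ := hvs ⟨i, hiT⟩ _ (hw' i) (hcomp i)
        rw [← hc]
        exact Submodule.smul_mem _ _ (Submodule.subset_span (Set.mem_range_self _))
  rw [← hspan, finrank_span_eq_card hli, ← Nat.card_eq_fintype_card, Nat.card_coe_set_eq]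

theorem IsEvenSl2Triple.multTrivAdjEq_iff [FiniteDimensional ℂ V] (ht : A.IsEvenSl2Triple e x f)
    (hnat : A.natural e x f ≤ A.part 0) (hc : HasStableComplements (A.actingOperators e x f))
    (k : ℕ) : A.MultTrivAdjEq e x f k ↔
      Module.finrank ℂ (A.highestWeightVectors e x f) = k := by
  have hex := A.exists_isDecomposition e x f hc
  constructor
  · rintro ⟨⟨r, ρ, hρ⟩, h⟩
    rw [← h r ρ hρ, ht.ncard_isTrivAdj hnat hρ]
  · rintro rfl
    exact ⟨hex, fun r ρ hρ => ht.ncard_isTrivAdj hnat hρ⟩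

end LieSuperalgebra

end

noncomputable section

/-! ### The centralizer and the highest weight matrices on `⨁ V(d j - 1)` -/

namespace Sl2Model

open Matrix

variable {J : Type*} [Fintype J] [DecidableEq J] (d : J → ℕ)

/-- Square matrices on the standard basis of `⨁ j, V(d j - 1)`. -/
abbrev Mat (d : J → ℕ) : Type _ := Matrix (Σ j, Fin (d j)) (Σ j, Fin (d j)) ℂ

/-- The matrix of `e` on `⨁ j, V(d j - 1)`. -/
def matE : Mat d := Matrix.of fun i k =>
  if i.1 = k.1 ∧ (i.2 : ℕ) + 1 = k.2 then (((k.2 : ℕ) : ℂ) * ((d k.1 : ℂ) - (k.2 : ℕ))) / 2 else 0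

/-- The matrix of `f` on `⨁ j, V(d j - 1)`. -/
def matF : Mat d := Matrix.of fun i k => if i.1 = k.1 ∧ (i.2 : ℕ) = k.2 + 1 then 1 else 0

/-- The matrix of `x` on `⨁ j, V(d j - 1)`. -/
def matX : Mat d := diagonal fun i => ((d i.1 : ℂ) - 1) / 2 - (i.2 : ℕ)

variable {d}

theorem matE_mul_apply (M : Mat d) (j : J) (a : ℕ) (h : a + 1 < d j) (k : Σ j, Fin (d j)) :
    (matE d * M) ⟨j, ⟨a, by omega⟩⟩ k =
      (((a + 1 : ℕ) : ℂ) * ((d j : ℂ) - (a + 1 : ℕ))) / 2 * M ⟨j, ⟨a + 1, h⟩⟩ k := by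
  rw [Matrix.mul_apply, Finset.sum_eq_single ⟨j, ⟨a + 1, h⟩⟩]
  · simp [matE]
  · rintro ⟨l, b, hb⟩ - hne
    simp only [matE, Matrix.of_apply]
    rw [if_neg, zero_mul]
    rintro ⟨rfl, hab⟩
    apply hne
    subst hab
    rfl
  · simp

theorem mul_matE_apply (M : Mat d) (i : Σ j, Fin (d j)) (j : J) (a : ℕ) (h : a + 1 < d j) :
    (M * matE d) i ⟨j, ⟨a + 1, h⟩⟩ =
      M i ⟨j, ⟨a, by omega⟩⟩ * ((((a + 1 : ℕ) : ℂ) * ((d j : ℂ) - (a + 1 : ℕ))) / 2) := by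
  rw [Matrix.mul_apply, Finset.sum_eq_single ⟨j, ⟨a, by omega⟩⟩]
  · simp [matE]
  · rintro ⟨l, b, hb⟩ - hne
    simp only [matE, Matrix.of_apply]
    rw [if_neg, mul_zero]
    rintro ⟨rfl, hab⟩
    apply hne
    simp only [add_left_inj] at hab
    subst hab
    rfl
  · simp

theorem mul_matE_apply_zero (M : Mat d) (i : Σ j, Fin (d j)) (j : J) (h : 0 < d j) :
    (M * matE d) i ⟨j, ⟨0, h⟩⟩ = 0 := by
  rw [Matrix.mul_apply, Finset.sum_eq_zero]
  rintro ⟨l, b, hb⟩ -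
  simp [matE]

/-- The Casimir operator separates the dimensions: its eigenvalue `(q² - 1)/4` on `V(q - 1)`
determines `q`. -/
theorem casimir : (2 : ℂ) • (matF d * matE d) + matX d * matX d + matX d =
    diagonal fun i => ((d i.1 : ℂ) ^ 2 - 1) / 4 := by
  ext i ⟨j, b, hb⟩
  rw [Matrix.add_apply, Matrix.add_apply, Matrix.smul_apply, matX, diagonal_mul_diagonal]
  rcases b with _ | b
  · rw [mul_matE_apply_zero]
    by_cases h : i = ⟨j, ⟨0, hb⟩⟩
    · subst h
      simp
      ring
    · simp [h]
  · rw [mul_matE_apply]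
    by_cases h : i = ⟨j, ⟨b + 1, hb⟩⟩
    · subst h
      simp [matF]
      ring
    · have : matF d i ⟨j, ⟨b, by omega⟩⟩ = 0 := by
        obtain ⟨l, a, ha⟩ := i
        simp only [matF, Matrix.of_apply]
        rw [if_neg]
        rintro ⟨rfl, hab⟩
        apply h
        subst hab
        rfl
      simp [h, this]

/-- The matrix `Z` centralizes the triple. -/
def Centralizes (Z : Mat d) : Prop :=
  Commute Z (matE d) ∧ Commute Z (matX d) ∧ Commute Z (matF d)

/-- `Z` commutes with the Casimir operator, so its entries between summands of different dimensions
vanish; any function of the dimension then commutes with `Z` as well. -/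
theorem Centralizes.commute_diagonal {Z : Mat d} (hZ : Centralizes Z) (c : ℕ → ℂ) :
    Commute Z (diagonal fun i => c (d i.1)) := by
  have h : Commute Z (diagonal fun i => ((d i.1 : ℂ) ^ 2 - 1) / 4) := by
    rw [← casimir]
    exact ((hZ.2.2.mul_right hZ.1).smul_right 2 |>.add_right (hZ.2.1.mul_right hZ.2.1)).add_right
      hZ.2.1
  ext i k
  have hik := congrFun (congrFun h.eq i) k
  rw [mul_diagonal, diagonal_mul] at hik ⊢
  by_cases hz : Z i k = 0
  · simp [hz]
  · have h1 : (d i.1 : ℂ) ^ 2 = (d k.1 : ℂ) ^ 2 := by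
      have : Z i k * (((d k.1 : ℂ) ^ 2 - 1) / 4 - ((d i.1 : ℂ) ^ 2 - 1) / 4) = 0 := by
        linear_combination hik
      have := (mul_eq_zero.1 this).resolve_left hz
      linear_combination -4 * this
    have h2 : d i.1 = d k.1 := by
      have h3 : d i.1 ^ 2 = d k.1 ^ 2 := by exact_mod_cast h1
      exact Nat.pow_left_injective two_ne_zero h3
    rw [h2, mul_comm]

/-- The matrix of the isomorphism from the `k`-th to the `j`-th summand. -/
def blockUnit (j k : J) : Mat d := Matrix.of fun i l =>
  if i.1 = j ∧ l.1 = k ∧ (i.2 : ℕ) = l.2 then 1 else 0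

theorem blockUnit_mul_apply {j k : J} (hd : d j = d k) (M : Mat d) (a : Fin (d j))
    (l : Σ j, Fin (d j)) : ((blockUnit j k : Mat d) * M) ⟨j, a⟩ l = M ⟨k, Fin.cast hd a⟩ l := by
  rw [Matrix.mul_apply, Finset.sum_eq_single ⟨k, Fin.cast hd a⟩]
  · simp [blockUnit]
  · rintro ⟨l, b, hb⟩ - hne
    simp only [blockUnit, Matrix.of_apply]
    rw [if_neg, zero_mul]
    rintro ⟨-, rfl, hab⟩
    apply hne
    subst hab
    rfl
  · simp

theorem blockUnit_mul_apply_of_ne {j k : J} (M : Mat d) {i : Σ j, Fin (d j)} (hi : i.1 ≠ j)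
    (l : Σ j, Fin (d j)) : ((blockUnit j k : Mat d) * M) i l = 0 := by
  rw [Matrix.mul_apply, Finset.sum_eq_zero]
  intro l _
  simp [blockUnit, hi]

theorem mul_blockUnit_apply {j k : J} (hd : d j = d k) (M : Mat d) (a : Fin (d k))
    (l : Σ j, Fin (d j)) : (M * (blockUnit j k : Mat d)) l ⟨k, a⟩ = M l ⟨j, Fin.cast hd.symm a⟩ := by
  rw [Matrix.mul_apply, Finset.sum_eq_single ⟨j, Fin.cast hd.symm a⟩]
  · simp [blockUnit]
  · rintro ⟨l, b, hb⟩ - hne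
    simp only [blockUnit, Matrix.of_apply]
    rw [if_neg, mul_zero]
    rintro ⟨rfl, -, hab⟩
    apply hne
    subst hab
    rfl
  · simp

theorem mul_blockUnit_apply_of_ne {j k : J} (M : Mat d) {i : Σ j, Fin (d j)} (hi : i.1 ≠ k)
    (l : Σ j, Fin (d j)) : (M * (blockUnit j k : Mat d)) l i = 0 := by
  rw [Matrix.mul_apply, Finset.sum_eq_zero]
  intro l _
  simp [blockUnit, hi]

/-- A block diagonal matrix with equal `j`-th and `k`-th blocks commutes with the identification of
these two summands; `matE`, `matX`, `matF` are of this kind whenever `d j = d k`. -/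
theorem commute_blockUnit {j k : J} (hd : d j = d k) {M : Mat d}
    (h1 : ∀ i l, i.1 ≠ l.1 → M i l = 0)
    (h2 : ∀ a b : Fin (d k), M ⟨j, Fin.cast hd.symm a⟩ ⟨j, Fin.cast hd.symm b⟩ = M ⟨k, a⟩ ⟨k, b⟩) :
    Commute (blockUnit j k) M := by
  ext i l
  by_cases hi : i.1 = j
  · obtain ⟨i, a⟩ := i
    subst hi
    rw [blockUnit_mul_apply hd]
    by_cases hl : l.1 = k
    · obtain ⟨l, b⟩ := l
      subst hl
      rw [mul_blockUnit_apply hd, ← h2]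
      rfl
    · rw [mul_blockUnit_apply_of_ne _ hl, h1]
      exact fun h => hl h.symm
  · rw [blockUnit_mul_apply_of_ne _ hi]
    by_cases hl : l.1 = k
    · obtain ⟨l, b⟩ := l
      subst hl
      rw [mul_blockUnit_apply hd, h1]
      exact hi
    · rw [mul_blockUnit_apply_of_ne _ hl]

theorem centralizes_blockUnit {j k : J} (hd : d j = d k) :
    Centralizes (blockUnit j k : Mat d) := by
  refine ⟨commute_blockUnit hd ?_ ?_, commute_blockUnit hd ?_ ?_, commute_blockUnit hd ?_ ?_⟩
  · intro i l h; simp [matE, h]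
  · intro a b; simp [matE, hd]
  · intro i l h
    rw [matX, diagonal_apply_ne]
    exact fun h' => h (congrArg _ h')
  · intro a b
    by_cases h : a = b
    · subst h; simp [matX, hd]
    · have h' : Fin.cast hd.symm a ≠ Fin.cast hd.symm b := fun h' => h (Fin.cast_injective _ h')
      simp [matX, h]
  · intro i l h; simp [matF, h]
  · intro a b; simp [matF]

theorem centralizes_diagonal (c : J → ℂ) :
    Centralizes (diagonal fun i : Σ j, Fin (d j) => c i.1) := by
  refine ⟨?_, ?_, ?_⟩
  · ext i k
    rw [diagonal_mul, mul_diagonal]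
    by_cases h : i.1 = k.1
    · rw [h, mul_comm]
    · simp [matE, h]
  · exact commute_diagonal _ _
  · ext i k
    rw [diagonal_mul, mul_diagonal]
    by_cases h : i.1 = k.1
    · rw [h, mul_comm]
    · simp [matF, h]

/-- The matrix of the grading operator that acts by `s j` on the `j`-th summand. -/
def matS (s : J → ℂ) : Mat d := diagonal fun i => s i.1

theorem trace_matS_mul (s : J → ℂ) (M : Mat d) :
    trace (matS s * M) = ∑ i, s i.1 * M i i := by
  simp [trace, matS, diagonal_mul]

theorem trace_matS_mul_diagonal (s c : J → ℂ) :
    trace (matS s * diagonal fun i : Σ j, Fin (d j) => c i.1) = ∑ j, d j * (s j * c j) := by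
  rw [trace_matS_mul, Fintype.sum_sigma]
  simp

theorem trace_matS_mul_blockUnit (s : J → ℂ) {j k : J} (h : j ≠ k) :
    trace (matS s * blockUnit j k : Mat d) = 0 := by
  rw [trace_matS_mul, Finset.sum_eq_zero]
  intro i _
  rw [blockUnit, Matrix.of_apply, if_neg, mul_zero]
  rintro ⟨rfl, h', -⟩
  exact h h'

theorem eq_of_commute_matS {s : J → ℂ} {j k : J} (hd : d j = d k) (hpos : 0 < d j)
    (h : Commute (matS s) (blockUnit j k : Mat d)) : s j = s k := by
  have := congrFun (congrFun h.eq ⟨j, ⟨0, hpos⟩⟩) ⟨k, ⟨0, hd ▸ hpos⟩⟩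
  simpa [matS, diagonal_mul, mul_diagonal, blockUnit] using this

/-- The matrices of weight `1` that commute with `e` and with the supertraceless matrices
centralizing the triple. -/
def highestWeight (s : J → ℂ) : Submodule ℂ (Mat d) where
  carrier := {M | (∀ Z, Centralizes Z → trace (matS s * Z) = 0 → Commute Z M) ∧
    Commute (matE d) M ∧ matX d * M - M * matX d = M}
  add_mem' := by
    rintro a b ⟨h1, h2, h3⟩ ⟨k1, k2, k3⟩
    refine ⟨fun Z hZ ht => (h1 Z hZ ht).add_right (k1 Z hZ ht), h2.add_right k2, ?_⟩
    rw [mul_add, add_mul, add_sub_add_comm, h3, k3]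
  zero_mem' := by simp
  smul_mem' := by
    rintro c a ⟨h1, h2, h3⟩
    refine ⟨fun Z hZ ht => (h1 Z hZ ht).smul_right c, h2.smul_right c, ?_⟩
    rw [Matrix.mul_smul, Matrix.smul_mul, ← smul_sub, h3]

theorem diagonal_mul_matE_mem_highestWeight (s : J → ℂ) (c : ℕ → ℂ) :
    (diagonal fun i => c (d i.1)) * matE d ∈ highestWeight s := by
  refine ⟨fun Z hZ _ => (hZ.commute_diagonal c).mul_right hZ.1, ?_, ?_⟩
  · exact ((centralizes_diagonal fun j => c (d j)).1.symm).mul_right (Commute.refl _)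
  · ext i k
    rw [Matrix.sub_apply, matX, diagonal_mul, mul_diagonal, diagonal_mul]
    obtain ⟨j, a⟩ := i
    obtain ⟨l, b⟩ := k
    by_cases h : j = l ∧ (a : ℕ) + 1 = b
    · obtain ⟨rfl, hab⟩ := h
      simp only [← hab]
      push_cast
      ring
    · simp [matE, h]

/-- The test matrix is a supertraceless matrix that is scalar on each summand and takes different
values on the two summands in question. Equality of signs in equal dimensions is what makes such a
matrix exist. -/
theorem apply_eq_zero_of_mem_highestWeight {s : J → ℂ} (hpos : ∀ j, 0 < d j)
    (hs : ∀ j, s j = 1 ∨ s j = -1) (hsd : ∀ j k, d j = d k → s j = s k) {M : Mat d}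
    (hM : M ∈ highestWeight s) {i k : Σ j, Fin (d j)} (hik : i.1 ≠ k.1) : M i k = 0 := by
  -- The contributions to the supertrace are `s i d i s k d k` and its negative, and the two values
  -- differ by `s k d k + s i d i`.
  let c : J → ℂ := Pi.single i.1 (s k.1 * d k.1) + Pi.single k.1 (-(s i.1 * d i.1))
  have hci : c i.1 = s k.1 * d k.1 := by simp [c, hik]
  have hck : c k.1 = -(s i.1 * d i.1) := by simp [c, hik.symm]
  have htr : trace (matS s * diagonal fun i : Σ j, Fin (d j) => c i.1) = 0 := by
    rw [trace_matS_mul_diagonal]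
    simp only [c, Pi.add_apply, mul_add, Finset.sum_add_distrib, Pi.single_apply, mul_ite, mul_zero,
      Finset.sum_ite_eq', Finset.mem_univ, if_true]
    simp
    ring
  have h := congrFun (congrFun (hM.1 _ (centralizes_diagonal c) htr).eq i) k
  rw [diagonal_mul, mul_diagonal, hci, hck] at h
  -- For equal dimensions the signs agree and the sum is `±2 d i`; for different positive dimensions
  -- `±d i ± d k` cannot vanish.
  have hne : s k.1 * d k.1 + s i.1 * d i.1 ≠ 0 := by
    have hi : (d i.1 : ℂ) ≠ 0 := Nat.cast_ne_zero.2 (hpos _).ne'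
    by_cases hd : d i.1 = d k.1
    · rw [← hd, ← hsd _ _ hd]
      rcases hs i.1 with h | h <;> rw [h] <;> intro h0 <;> apply hi <;>
        [linear_combination h0 / 2; linear_combination -h0 / 2]
    · have h1 : (d i.1 : ℂ) ≠ d k.1 := fun h => hd (by exact_mod_cast h)
      have h2 : (d i.1 : ℂ) + d k.1 ≠ 0 := by
        have := hpos i.1
        exact_mod_cast (by omega : d i.1 + d k.1 ≠ 0)
      intro h0
      rcases hs i.1 with h | h <;> rcases hs k.1 with h' | h' <;> rw [h, h'] at h0
      · exact h2 (by linear_combination h0)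
      · exact h1 (by linear_combination h0)
      · exact h1 (by linear_combination -h0)
      · exact h2 (by linear_combination -h0)
  have : (s k.1 * d k.1 + s i.1 * d i.1) * M i k = 0 := by linear_combination h
  exact (mul_eq_zero.1 this).resolve_left hne

theorem weight_coeff_ne_zero {n a : ℕ} (h : a + 1 < n) :
    (((a + 1 : ℕ) : ℂ) * ((n : ℂ) - (a + 1 : ℕ))) / 2 ≠ 0 := by
  refine div_ne_zero (mul_ne_zero (Nat.cast_ne_zero.2 (by omega)) ?_) two_ne_zero
  rw [sub_ne_zero]
  exact_mod_cast (by omega : n ≠ a + 1)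

theorem exists_eq_of_mem_highestWeight {s : J → ℂ} (hpos : ∀ j, 0 < d j)
    (hs : ∀ j, s j = 1 ∨ s j = -1) (hsd : ∀ j k, d j = d k → s j = s k) {M : Mat d}
    (hM : M ∈ highestWeight s) :
    ∃ c : ℕ → ℂ, M = (diagonal fun i => c (d i.1)) * matE d := by
  classical
  -- The multiple of `e` on the `j`-th block, read off from the entry at `(0, 1)`. A one-dimensional
  -- summand has no such entry, and there `e = 0`, so the default `0` is harmless.
  let c' : J → ℂ := fun j => if h : 1 < d j then
    M ⟨j, ⟨0, hpos j⟩⟩ ⟨j, ⟨1, h⟩⟩ / ((((0 + 1 : ℕ) : ℂ) * ((d j : ℂ) - (0 + 1 : ℕ))) / 2) else 0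
  have hc' : ∀ j k, d j = d k → c' j = c' k := by
    intro j k hd
    by_cases hjk : j = k
    · rw [hjk]
    by_cases h : 1 < d j
    · have h' : 1 < d k := hd ▸ h
      have hc := hM.1 _ (centralizes_blockUnit hd) (trace_matS_mul_blockUnit s hjk)
      have := congrFun (congrFun hc.eq ⟨j, ⟨0, hpos j⟩⟩) ⟨k, ⟨1, h'⟩⟩
      rw [blockUnit_mul_apply hd, mul_blockUnit_apply hd] at this
      simp only [c', h, h', dif_pos]
      have hdc : (d j : ℂ) = d k := by rw [hd]
      rw [hdc]
      congr 1
      exact this.symm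
    · have h' : ¬ 1 < d k := hd ▸ h
      simp only [c', h, h', dif_neg, not_false_eq_true]
  -- Commutation with `e` relates consecutive superdiagonal entries, and the coefficients of `e` are
  -- nonzero, so the first entry determines the others.
  have hrow : ∀ j a (h : a + 1 < d j), M ⟨j, ⟨a, by omega⟩⟩ ⟨j, ⟨a + 1, h⟩⟩ =
      c' j * ((((a + 1 : ℕ) : ℂ) * ((d j : ℂ) - (a + 1 : ℕ))) / 2) := by
    intro j a
    induction a with
    | zero =>
      intro h
      have h1 : 1 < d j := h
      simp only [c', h1, dif_pos]
      rw [div_mul_cancel₀ _ (weight_coeff_ne_zero h)]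
    | succ a ih =>
      intro h
      have h1 := congrFun (congrFun hM.2.1.eq ⟨j, ⟨a, by omega⟩⟩) ⟨j, ⟨a + 1 + 1, h⟩⟩
      rw [matE_mul_apply M j a (by omega), mul_matE_apply, ih (by omega)] at h1
      apply mul_left_cancel₀ (weight_coeff_ne_zero (show a + 1 < d j by omega))
      rw [h1]
      ring
  refine ⟨fun q => if h : ∃ j, d j = q then c' h.choose else 0, ?_⟩
  have hcd : ∀ j, (if h : ∃ k, d k = d j then c' h.choose else 0) = c' j := by
    intro j
    have h : ∃ k, d k = d j := ⟨j, rfl⟩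
    rw [dif_pos h]
    exact hc' _ _ h.choose_spec
  ext i k
  rw [diagonal_mul]
  simp only [hcd]
  by_cases h : i.1 = k.1
  · obtain ⟨j, a, ha⟩ := i
    obtain ⟨l, b, hb⟩ := k
    subst h
    by_cases hab : a + 1 = b
    · subst hab
      rw [hrow]
      simp [matE]
    · have h0 := congrFun (congrFun hM.2.2 ⟨j, ⟨a, ha⟩⟩) ⟨j, ⟨b, hb⟩⟩
      rw [Matrix.sub_apply, matX, diagonal_mul, mul_diagonal] at h0
      simp only at h0
      -- Within a block the entry `(a, b)` has weight `b - a`, so weight `1` leaves only the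
      -- superdiagonal.
      have h1 : ((b : ℂ) - a - 1) * M ⟨j, ⟨a, ha⟩⟩ ⟨j, ⟨b, hb⟩⟩ = 0 := by linear_combination h0
      have h2 : (b : ℂ) - a - 1 ≠ 0 := by
        intro h2
        have : (b : ℂ) = (a + 1 : ℕ) := by push_cast; linear_combination h2
        exact hab (by exact_mod_cast this.symm)
      rw [(mul_eq_zero.1 h1).resolve_left h2]
      simp [matE, hab]
  · rw [apply_eq_zero_of_mem_highestWeight hpos hs hsd hM h]
    simp [matE, h]

variable (d) in
/-- The distinct dimensions greater than `1` of the summands. -/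
def bigDims : Finset ℕ := (Finset.univ.image d).filter (1 < ·)

variable (d) in
/-- The extension by zero of a function on the set of distinct dimensions greater than `1`. -/
def extendBigDims : (bigDims d → ℂ) →ₗ[ℂ] (ℕ → ℂ) where
  toFun c q := if h : q ∈ bigDims d then c ⟨q, h⟩ else 0
  map_add' c c' := by ext q; simp only [Pi.add_apply]; split_ifs <;> simp
  map_smul' r c := by ext q; simp only [Pi.smul_apply, RingHom.id_apply]; split_ifs <;> simp

variable (d) in
/-- The linear map to matrices that sends a function `c` to the operator that acts by `c q • e` on
the summands of dimension `q`. -/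
def scaledE : (ℕ → ℂ) →ₗ[ℂ] Mat d where
  toFun c := (diagonal fun i => c (d i.1)) * matE d
  map_add' c c' := by rw [← add_mul, diagonal_add]; rfl
  map_smul' r c := by rw [RingHom.id_apply, ← smul_mul_assoc, ← diagonal_smul]; rfl

theorem scaledE_apply (c : ℕ → ℂ) (i k : Σ j, Fin (d j)) :
    scaledE d c i k = c (d i.1) * matE d i k := diagonal_mul _ _ _ _

theorem mem_bigDims {q : ℕ} : q ∈ bigDims d ↔ (∃ j, d j = q) ∧ 1 < q := by
  simp [bigDims]

theorem scaledE_extendBigDims_injective (hpos : ∀ j, 0 < d j) :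
    Function.Injective (scaledE d ∘ₗ extendBigDims d) := by
  rw [← LinearMap.ker_eq_bot, LinearMap.ker_eq_bot']
  intro c hc
  ext ⟨q, hq⟩
  obtain ⟨⟨j, rfl⟩, h1⟩ := mem_bigDims.1 hq
  have h := congrFun (congrFun hc ⟨j, ⟨0, hpos j⟩⟩) ⟨j, ⟨0 + 1, h1⟩⟩
  rw [LinearMap.comp_apply, scaledE_apply] at h
  simp only [matE, Matrix.of_apply, and_self, if_true] at h
  have h3 := (mul_eq_zero.1 h).resolve_right (weight_coeff_ne_zero h1)
  simpa [extendBigDims, hq] using h3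

theorem range_scaledE_extendBigDims {s : J → ℂ} (hpos : ∀ j, 0 < d j)
    (hs : ∀ j, s j = 1 ∨ s j = -1) (hsd : ∀ j k, d j = d k → s j = s k) :
    LinearMap.range (scaledE d ∘ₗ extendBigDims d) = highestWeight s := by
  apply le_antisymm
  · rintro _ ⟨c, rfl⟩
    exact diagonal_mul_matE_mem_highestWeight s _
  · intro M hM
    obtain ⟨c, rfl⟩ := exists_eq_of_mem_highestWeight hpos hs hsd hM
    refine ⟨fun q => c q, ?_⟩
    ext i k
    rw [LinearMap.comp_apply, scaledE_apply, diagonal_mul]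
    by_cases h : d i.1 ∈ bigDims d
    · simp [extendBigDims, h]
    · have : matE d i k = 0 := by
        simp only [matE, Matrix.of_apply]
        rw [if_neg]
        rintro ⟨h1, h2⟩
        have := k.2.isLt
        exact h (mem_bigDims.2 ⟨⟨_, rfl⟩, by rw [h1]; omega⟩)
      rw [this, mul_zero, mul_zero]

theorem finrank_highestWeight {s : J → ℂ} (hpos : ∀ j, 0 < d j)
    (hs : ∀ j, s j = 1 ∨ s j = -1) (hsd : ∀ j k, d j = d k → s j = s k) :
    Module.finrank ℂ (highestWeight (d := d) s) = (bigDims d).card := by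
  rw [← range_scaledE_extendBigDims hpos hs hsd,
    LinearMap.finrank_range_of_inj (scaledE_extendBigDims_injective hpos),
    Module.finrank_fintype_fun_eq_card, Fintype.card_coe]

/-! ### The invariant inner product -/

variable (d) in
/-- The squared lengths of the standard basis vectors for an inner product on `⨁ j, V(d j - 1)`
for which `f` is the adjoint of `e`. -/
def sqLength (i : Σ j, Fin (d j)) : ℝ :=
  ∏ a ∈ Finset.range i.2, (((a + 1 : ℕ) : ℝ) * ((d i.1 : ℝ) - (a + 1 : ℕ))) / 2

theorem sqLength_pos (i : Σ j, Fin (d j)) : 0 < sqLength d i := by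
  refine Finset.prod_pos fun a ha => ?_
  have h1 := Finset.mem_range.1 ha
  have h2 := i.2.isLt
  have h3 : ((a + 1 : ℕ) : ℝ) < d i.1 := by exact_mod_cast (by omega : a + 1 < d i.1)
  have h4 : (0 : ℝ) < (a + 1 : ℕ) := by positivity
  have := sub_pos.2 h3
  positivity

variable (d) in
/-- The Gram matrix of the standard basis. -/
def gram : Mat d := diagonal fun i => (sqLength d i : ℂ)

variable (d) in
/-- The inverse of the Gram matrix of the standard basis. -/
def gramInv : Mat d := diagonal fun i => (sqLength d i : ℂ)⁻¹

theorem sqLength_ne_zero (i : Σ j, Fin (d j)) : (sqLength d i : ℂ) ≠ 0 :=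
  Complex.ofReal_ne_zero.2 (sqLength_pos i).ne'

@[simp]
theorem gram_mul_gramInv : gram d * gramInv d = 1 := by
  rw [gram, gramInv, diagonal_mul_diagonal, ← diagonal_one]
  congr 1
  ext i
  exact mul_inv_cancel₀ (sqLength_ne_zero i)

@[simp]
theorem gramInv_mul_gram : gramInv d * gram d = 1 := by
  rw [gram, gramInv, diagonal_mul_diagonal, ← diagonal_one]
  congr 1
  ext i
  exact inv_mul_cancel₀ (sqLength_ne_zero i)

@[simp]
theorem conjTranspose_gram : (gram d)ᴴ = gram d := by
  simp only [gram, diagonal_conjTranspose]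
  congr 1
  ext i
  simp

@[simp]
theorem conjTranspose_gramInv : (gramInv d)ᴴ = gramInv d := by
  simp only [gramInv, diagonal_conjTranspose]
  congr 1
  ext i
  simp

/-- The adjoint with respect to the inner product on `⨁ j, V(d j - 1)`. -/
def adj (Z : Mat d) : Mat d := gramInv d * Zᴴ * gram d

theorem adj_mul (Y Z : Mat d) : adj (Y * Z) = adj Z * adj Y := by
  simp only [adj, conjTranspose_mul]
  calc gramInv d * (Zᴴ * Yᴴ) * gram d = gramInv d * Zᴴ * 1 * Yᴴ * gram d := by noncomm_ring
    _ = _ := by rw [← gram_mul_gramInv]; noncomm_ring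

theorem adj_adj (Z : Mat d) : adj (adj Z) = Z := by
  simp only [adj, conjTranspose_mul, conjTranspose_gram, conjTranspose_gramInv,
    conjTranspose_conjTranspose]
  calc gramInv d * (gram d * (Z * gramInv d)) * gram d
      = (gramInv d * gram d) * Z * (gramInv d * gram d) := by noncomm_ring
    _ = Z := by simp

/-- With `f v_a = v_{a+1}` and `e v_{a+1} = t v_a`, adjointness requires `|v_{a+1}|² = t |v_a|²`,
which is the recursion defining `sqLength`. -/
theorem adj_matE : adj (matE d) = matF d := by
  ext ⟨j, b⟩ ⟨l, a⟩
  rw [adj, gram, gramInv, mul_diagonal, diagonal_mul, conjTranspose_apply]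
  by_cases h : l = j ∧ (a : ℕ) + 1 = b
  · obtain ⟨rfl, hab⟩ := h
    have h1 : sqLength d ⟨l, b⟩ = sqLength d ⟨l, a⟩ *
        ((((a + 1 : ℕ) : ℝ) * ((d l : ℝ) - (a + 1 : ℕ))) / 2) := by
      rw [sqLength, ← hab, Finset.prod_range_succ, sqLength]
    have h2 : matE d ⟨l, a⟩ ⟨l, b⟩ =
        (((((a + 1 : ℕ) : ℝ) * ((d l : ℝ) - (a + 1 : ℕ))) / 2 : ℝ) : ℂ) := by
      simp [matE, ← hab]
    have h3 : matF d ⟨l, b⟩ ⟨l, a⟩ = 1 := by simp [matF, ← hab]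
    have h4 := sqLength_ne_zero (d := d) ⟨l, b⟩
    rw [h3, h2, Complex.star_def, Complex.conj_ofReal, mul_assoc, mul_comm _ (Complex.ofReal _),
      ← Complex.ofReal_mul, ← h1, inv_mul_cancel₀ h4]
  · have h3 : matF d ⟨j, b⟩ ⟨l, a⟩ = 0 := by
      simp only [matF, Matrix.of_apply]
      rw [if_neg]
      exact fun h' => h ⟨h'.1.symm, h'.2.symm⟩
    rw [h3]
    simp only [matE, Matrix.of_apply, h, if_false]
    simp

theorem adj_matF : adj (matF d) = matE d := by rw [← adj_matE, adj_adj]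

theorem adj_matX : adj (matX d) = matX d := by
  rw [adj, gram, gramInv, matX, diagonal_conjTranspose, diagonal_mul_diagonal,
    diagonal_mul_diagonal]
  congr 1
  ext i
  have := sqLength_ne_zero i
  simp
  field_simp

theorem Centralizes.adj {Z : Mat d} (hZ : Centralizes Z) : Centralizes (adj Z) := by
  have key : ∀ {Y : Mat d}, Commute Z Y → Commute (Sl2Model.adj Z) (Sl2Model.adj Y) := by
    intro Y h
    rw [commute_iff_eq, ← adj_mul, ← adj_mul, h.eq]
  exact ⟨adj_matF (d := d) ▸ key hZ.2.2, adj_matX (d := d) ▸ key hZ.2.1,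
    adj_matE (d := d) ▸ key hZ.1⟩

/-- Makes supertraceless matrices closed under adjoints: conjugation by the diagonal Gram matrix
leaves diagonal entries alone, and the signs are real. -/
theorem trace_matS_mul_adj {s : J → ℂ} (hs : ∀ j, s j = 1 ∨ s j = -1) (Z : Mat d) :
    trace (matS s * adj Z) = star (trace (matS s * Z)) := by
  rw [trace_matS_mul, trace_matS_mul, star_sum]
  refine Finset.sum_congr rfl fun i _ => ?_
  have h : star (s i.1) = s i.1 := by rcases hs i.1 with h | h <;> rw [h] <;> simp
  have := sqLength_ne_zero i
  rw [star_mul', h, adj, gram, gramInv, mul_diagonal, diagonal_mul, conjTranspose_apply]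
  field_simp

variable (d) in
/-- The Hilbert-Schmidt inner product on the matrices of operators on `⨁ j, V(d j - 1)`. -/
@[reducible]
def innerCore : InnerProductSpace.Core ℂ (Mat d) :=
  have hexp : ∀ A B : Mat d, trace (adj A * B) =
      ∑ k, ∑ i, (sqLength d k : ℂ)⁻¹ * star (A i k) * sqLength d i * B i k := by
    intro A B
    simp only [trace, diag, Matrix.mul_apply (N := B), adj, gram, gramInv, mul_diagonal,
      diagonal_mul, conjTranspose_apply]
  have hself : ∀ A : Mat d, trace (adj A * A) =
      ((∑ k, ∑ i, (sqLength d k)⁻¹ * sqLength d i * Complex.normSq (A i k) : ℝ) : ℂ) := by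
    intro A
    rw [hexp]
    push_cast
    refine Finset.sum_congr rfl fun k _ => Finset.sum_congr rfl fun i _ => ?_
    rw [Complex.normSq_eq_conj_mul_self, Complex.star_def]
    ring
  have hnn : ∀ (A : Mat d) k i,
      0 ≤ (sqLength d k)⁻¹ * sqLength d i * Complex.normSq (A i k) := fun A k i =>
    mul_nonneg (mul_nonneg (inv_nonneg.2 (sqLength_pos k).le) (sqLength_pos i).le)
      (Complex.normSq_nonneg _)
  { inner := fun A B => trace (adj A * B)
    conj_inner_symm := by
      intro A B
      change star (trace (adj B * A)) = _
      rw [← trace_conjTranspose, conjTranspose_mul]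
      simp only [adj, conjTranspose_mul, conjTranspose_gram, conjTranspose_gramInv,
        conjTranspose_conjTranspose]
      rw [trace_mul_comm, ← trace_mul_cycle, trace_mul_comm]
      simp only [← mul_assoc]
      rw [mul_assoc (gram d * B), trace_mul_comm]
      simp only [← mul_assoc]
    re_inner_nonneg := by
      intro A
      rw [hself]
      exact Finset.sum_nonneg fun k _ => Finset.sum_nonneg fun i _ => hnn A k i
    add_left := by
      intro A B C
      simp only [adj, conjTranspose_add, mul_add, add_mul, trace_add]
    smul_left := by
      intro A B r
      simp only [adj, conjTranspose_smul, Matrix.mul_smul, Matrix.smul_mul, trace_smul]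
      rfl
    definite := by
      intro A hA
      rw [hself, Complex.ofReal_eq_zero, Finset.sum_eq_zero_iff_of_nonneg
        fun k _ => Finset.sum_nonneg fun i _ => hnn A k i] at hA
      ext i k
      have h1 := hA k (Finset.mem_univ k)
      rw [Finset.sum_eq_zero_iff_of_nonneg fun i _ => hnn A k i] at h1
      have h2 := h1 i (Finset.mem_univ i)
      have h3 := (sqLength_pos i).ne'
      have h4 := (sqLength_pos k).ne'
      simpa [h3, h4] using h2 }

/-- The commutator with `adj Z` is adjoint to the commutator with `Z`, by cyclicity of the trace. -/
theorem innerCore_adj (Z A B : Mat d) :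
    (innerCore d).inner (adj Z * A - A * adj Z) B = (innerCore d).inner A (Z * B - B * Z) := by
  have hsub : ∀ P Q : Mat d, adj (P - Q) = adj P - adj Q := by
    intro P Q
    simp only [adj, conjTranspose_sub, mul_sub, sub_mul]
  change trace (adj _ * B) = trace (adj A * _)
  rw [hsub, adj_mul, adj_mul, adj_adj, sub_mul, mul_sub, trace_sub, trace_sub, mul_assoc,
    mul_assoc, trace_mul_comm Z, mul_assoc]

end Sl2Model

end

noncomputable section

open Matrix Sl2Model

/-- The pullback of an inner product along an injective linear map. -/
@[reducible]
def InnerProductSpace.Core.pullback {V W : Type*} [AddCommGroup V] [Module ℂ V] [AddCommGroup W]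
    [Module ℂ W] (c : InnerProductSpace.Core ℂ W) (φ : V →ₗ[ℂ] W) (hφ : Function.Injective φ) :
    InnerProductSpace.Core ℂ V where
  inner a b := c.inner (φ a) (φ b)
  conj_inner_symm _ _ := c.conj_inner_symm _ _
  re_inner_nonneg _ := c.re_inner_nonneg _
  add_left _ _ _ := by rw [map_add]; exact c.add_left _ _ _
  smul_left _ _ _ := by rw [map_smul]; exact c.smul_left _ _ _
  definite a ha := hφ (by rw [map_zero]; exact c.definite _ ha)

/-! ### Transport of `sl(m|n)` to standard form -/

namespace SuperMatrix

variable {m n : ℕ}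

/-- The matrix acting by `1` on `ℂ^m` and by `-1` on `ℂ^n`. -/
def signMatrix : SuperMatrix m n := Matrix.fromBlocks 1 0 0 (-1)

theorem supertrace_eq_trace (a : SuperMatrix m n) : supertrace a = trace (signMatrix * a) := by
  conv_rhs => rw [← Matrix.fromBlocks_toBlocks a]
  simp [signMatrix, Matrix.fromBlocks_multiply, Matrix.trace, supertrace, sub_eq_add_neg]

theorem mem_part_zero_iff_commute {a : SuperMatrix m n} :
    a ∈ part 0 ↔ Commute signMatrix a := by
  rw [mem_part_zero, commute_iff_eq]
  conv_rhs => rw [← Matrix.fromBlocks_toBlocks a]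
  simp only [signMatrix, oddPart, LinearMap.coe_mk, AddHom.coe_mk, Matrix.fromBlocks_multiply]
  simp only [Matrix.one_mul, Matrix.zero_mul, add_zero, zero_add, Matrix.mul_one, Matrix.mul_zero,
    Matrix.neg_mul, Matrix.mul_neg, Matrix.fromBlocks_inj, true_and, and_true]
  constructor
  · intro h
    have h1 : fromBlocks 0 a.toBlocks₁₂ a.toBlocks₂₁ 0 =
        fromBlocks (0 : Matrix (Fin m) (Fin m) ℂ) 0 0 (0 : Matrix (Fin n) (Fin n) ℂ) := by
      rw [fromBlocks_zero]; exact h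
    obtain ⟨-, h2, h3, -⟩ := Matrix.fromBlocks_inj.1 h1
    rw [h2, h3]
    simp
  · rintro ⟨h2, h3⟩
    have h2' : a.toBlocks₁₂ = 0 := by
      ext i j
      exact self_eq_neg.1 (congrFun (congrFun h2 i) j)
    have h3' : a.toBlocks₂₁ = 0 := by
      ext i j
      exact neg_eq_self.1 (congrFun (congrFun h3 i) j)
    rw [h2', h3', fromBlocks_zero]

theorem superBracket_of_even {a : SuperMatrix m n} (ha : a ∈ part 0) (b : SuperMatrix m n) :
    superBracket a b = a * b - b * a := by
  change a * b - (b * evenPart a + evenPart b * oddPart a - oddPart b * oddPart a) = _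
  rw [evenPart_of_mem ha, mem_part_zero.1 ha]
  simp

theorem mulVec_elim_of_even {a : SuperMatrix m n} (ha : a ∈ part 0) (v : Fin m → ℂ)
    (w : Fin n → ℂ) :
    a.mulVec (Sum.elim v w) = Sum.elim (a.toBlocks₁₁.mulVec v) (a.toBlocks₂₂.mulVec w) := by
  conv_lhs => rw [← evenPart_of_mem ha]
  simp [evenPart, Matrix.fromBlocks_mulVec]

/-- The algebra isomorphism sending a matrix to the matrix of the same operator in another basis. -/
def changeBasis {I N : Type*} [Fintype I] [DecidableEq I] [Fintype N] [DecidableEq N]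
    (b : Module.Basis I ℂ (N → ℂ)) : Matrix N N ℂ ≃ₐ[ℂ] Matrix I I ℂ :=
  Matrix.toLinAlgEquiv'.trans (LinearMap.toMatrixAlgEquiv b)

theorem changeBasis_apply {I N : Type*} [Fintype I] [DecidableEq I] [Fintype N] [DecidableEq N]
    (b : Module.Basis I ℂ (N → ℂ)) (a : Matrix N N ℂ) (i k : I) :
    changeBasis b a i k = b.repr (a.mulVec (b k)) i := by
  simp [changeBasis, LinearMap.toMatrixAlgEquiv_apply]

theorem trace_changeBasis {I N : Type*} [Fintype I] [DecidableEq I] [Fintype N] [DecidableEq N]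
    (b : Module.Basis I ℂ (N → ℂ)) (a : Matrix N N ℂ) : trace (changeBasis b a) = trace a := by
  have h := LinearMap.trace_eq_matrix_trace ℂ b (Matrix.toLin' a)
  rw [Matrix.trace_toLin'_eq] at h
  exact h.symm

/-- The algebra isomorphism `Ψ` brings the triple and the grading to standard form. -/
structure IsStandardForm {J : Type*} [Fintype J] [DecidableEq J] {d : J → ℕ} (s : J → ℂ)
    (Ψ : SuperMatrix m n ≃ₐ[ℂ] Mat d) (e x f : SuperMatrix m n) : Prop where
  pos : ∀ j, 0 < d j
  sign : ∀ j, s j = 1 ∨ s j = -1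
  trace : ∀ a, trace (Ψ a) = trace a
  map_e : Ψ e = matE d
  map_x : Ψ x = matX d
  map_f : Ψ f = matF d
  map_sign : Ψ signMatrix = matS s

theorem changeBasis_eq_of_mulVec {J N : Type*} [Fintype J] [DecidableEq J] [Fintype N]
    [DecidableEq N] {d : J → ℕ} (b : Module.Basis (Σ j, Fin (d j)) ℂ (N → ℂ)) {e x f : Matrix N N ℂ}
    (hx : ∀ j (a : Fin (d j)), x.mulVec (b ⟨j, a⟩) = (((d j : ℂ) - 1) / 2 - (a : ℕ)) • b ⟨j, a⟩)
    (hf : ∀ j (a : Fin (d j)), f.mulVec (b ⟨j, a⟩) =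
      if h : (a : ℕ) + 1 < d j then b ⟨j, ⟨a + 1, h⟩⟩ else 0)
    (he : ∀ j (a : Fin (d j)), e.mulVec (b ⟨j, a⟩) =
      ((((a : ℕ) : ℂ) * ((d j : ℂ) - (a : ℕ))) / 2) •
        b ⟨j, ⟨(a : ℕ) - 1, lt_of_le_of_lt (Nat.sub_le _ _) a.isLt⟩⟩) :
    changeBasis b e = matE d ∧ changeBasis b x = matX d ∧ changeBasis b f = matF d := by
  refine ⟨?_, ?_, ?_⟩ <;> ext ⟨j, a, ha⟩ ⟨l, c, hc⟩ <;> rw [changeBasis_apply]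
  · rw [he, map_smul, Module.Basis.repr_self, Finsupp.smul_apply, smul_eq_mul]
    rcases c with _ | c
    · simp [matE]
    · by_cases h : l = j ∧ c = a
      · obtain ⟨rfl, rfl⟩ := h
        simp [matE]
      · have h1 : matE d ⟨j, ⟨a, ha⟩⟩ ⟨l, ⟨c + 1, hc⟩⟩ = 0 := by
          simp only [matE, Matrix.of_apply]
          rw [if_neg]
          rintro ⟨rfl, h'⟩
          exact h ⟨rfl, by simpa using h'.symm⟩
        rw [h1, Finsupp.single_apply, if_neg, mul_zero]
        rintro h'
        obtain ⟨rfl, h2⟩ := Sigma.mk.inj_iff.1 h'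
        exact h ⟨rfl, by simpa using h2⟩
  · rw [hx, map_smul, Module.Basis.repr_self, Finsupp.smul_apply, smul_eq_mul, matX,
      Matrix.diagonal_apply, Finsupp.single_apply]
    by_cases h : (⟨j, ⟨a, ha⟩⟩ : Σ j, Fin (d j)) = ⟨l, ⟨c, hc⟩⟩
    · rw [if_pos h, if_pos h.symm, mul_one]
      obtain ⟨rfl, h2⟩ := Sigma.mk.inj_iff.1 h
      rw [eq_of_heq h2]
    · rw [if_neg h, if_neg (Ne.symm h), mul_zero]
  · rw [hf]
    simp only [matF, Matrix.of_apply]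
    by_cases h : j = l ∧ a = c + 1
    · obtain ⟨rfl, rfl⟩ := h
      simp [ha]
    · rw [if_neg h]
      split_ifs with hc'
      · rw [Module.Basis.repr_self, Finsupp.single_apply, if_neg]
        rintro h'
        obtain ⟨rfl, h2⟩ := Sigma.mk.inj_iff.1 h'
        exact h ⟨rfl, by simpa using h2.symm⟩
      · simp

/-- The bases of `ℂ^m` and `ℂ^n` given by the encoding are joined into one basis, indexed by the
summands of both. -/
theorem exists_isStandardForm {e x f : SuperMatrix m n} (he : e ∈ part 0) (hx : x ∈ part 0)
    (hf : f ∈ part 0) {α : m.Partition} {β : n.Partition} (h : IsEncodedBy e x f α β) :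
    ∃ (r₁ r₂ : ℕ) (d₁ : Fin r₁ → ℕ) (d₂ : Fin r₂ → ℕ)
      (Ψ : SuperMatrix m n ≃ₐ[ℂ] Mat (Sum.elim d₁ d₂)),
      Multiset.map d₁ Finset.univ.val = α.parts ∧ Multiset.map d₂ Finset.univ.val = β.parts ∧
      IsStandardForm (Sum.elim (fun _ => 1) (fun _ => -1)) Ψ e x f := by
  obtain ⟨⟨r₁, d₁, b₁, hα, h₁⟩, r₂, d₂, b₂, hβ, h₂⟩ := h
  let b : Module.Basis (Σ j, Fin (Sum.elim d₁ d₂ j)) ℂ (Fin m ⊕ Fin n → ℂ) :=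
    ((b₁.prod b₂).map (LinearEquiv.sumArrowLequivProdArrow (Fin m) (Fin n) ℂ ℂ).symm).reindex
      (Equiv.sumSigmaDistrib fun j => Fin (Sum.elim d₁ d₂ j)).symm
  have hb₁ : ∀ i (a : Fin (d₁ i)), b ⟨Sum.inl i, a⟩ = Sum.elim (b₁ ⟨i, a⟩) 0 := by
    intro i a
    have hb : b ⟨Sum.inl i, a⟩ = (LinearEquiv.sumArrowLequivProdArrow (Fin m) (Fin n) ℂ ℂ).symm
        ((b₁.prod b₂) (Sum.inl ⟨i, a⟩)) :=
      (Module.Basis.reindex_apply _ _ _).trans (Module.Basis.map_apply _ _ _)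
    rw [hb]
    ext (u | u)
    · change ((b₁.prod b₂) (Sum.inl ⟨i, a⟩)).1 u = _
      simp
    · change ((b₁.prod b₂) (Sum.inl ⟨i, a⟩)).2 u = _
      simp
  have hb₂ : ∀ i (a : Fin (d₂ i)), b ⟨Sum.inr i, a⟩ =
      Sum.elim (0 : Fin m → ℂ) (b₂ ⟨i, a⟩) := by
    intro i a
    have hb : b ⟨Sum.inr i, a⟩ = (LinearEquiv.sumArrowLequivProdArrow (Fin m) (Fin n) ℂ ℂ).symm
        ((b₁.prod b₂) (Sum.inr ⟨i, a⟩)) :=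
      (Module.Basis.reindex_apply _ _ _).trans (Module.Basis.map_apply _ _ _)
    rw [hb]
    ext (u | u)
    · change ((b₁.prod b₂) (Sum.inr ⟨i, a⟩)).1 u = _
      simp
    · change ((b₁.prod b₂) (Sum.inr ⟨i, a⟩)).2 u = _
      simp
  have hsl : ∀ (c : ℂ) (v : Fin m → ℂ), Sum.elim (c • v) (0 : Fin n → ℂ) = c • Sum.elim v 0 := by
    intro c v
    ext (u | u) <;> simp
  have hsr : ∀ (c : ℂ) (v : Fin n → ℂ), Sum.elim (0 : Fin m → ℂ) (c • v) =
      c • Sum.elim (0 : Fin m → ℂ) v := by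
    intro c v
    ext (u | u) <;> simp
  have hz : Sum.elim (0 : Fin m → ℂ) (0 : Fin n → ℂ) = 0 := by
    ext (u | u) <;> simp
  obtain ⟨hE, hX, hF⟩ := changeBasis_eq_of_mulVec b (e := e) (x := x) (f := f)
    (by
      rintro (j | j) a
      · erw [hb₁ j a, mulVec_elim_of_even hx, (h₁ j a).1, Matrix.mulVec_zero, hsl]
        rfl
      · erw [hb₂ j a, mulVec_elim_of_even hx, (h₂ j a).1, Matrix.mulVec_zero, hsr]
        rfl)
    (by
      rintro (j | j) a
      · erw [hb₁ j a, mulVec_elim_of_even hf, (h₁ j a).2.1, Matrix.mulVec_zero]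
        by_cases h : (a : ℕ) + 1 < d₁ j
        · rw [dif_pos h, dif_pos (show (a : ℕ) + 1 < Sum.elim d₁ d₂ (Sum.inl j) from h)]
          exact (hb₁ j _).symm
        · rw [dif_neg h, dif_neg (show ¬ (a : ℕ) + 1 < Sum.elim d₁ d₂ (Sum.inl j) from h), hz]
      · erw [hb₂ j a, mulVec_elim_of_even hf, (h₂ j a).2.1, Matrix.mulVec_zero]
        by_cases h : (a : ℕ) + 1 < d₂ j
        · rw [dif_pos h, dif_pos (show (a : ℕ) + 1 < Sum.elim d₁ d₂ (Sum.inr j) from h)]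
          exact (hb₂ j _).symm
        · rw [dif_neg h, dif_neg (show ¬ (a : ℕ) + 1 < Sum.elim d₁ d₂ (Sum.inr j) from h), hz])
    (by
      rintro (j | j) a
      · erw [hb₁ j a, mulVec_elim_of_even he, (h₁ j a).2.2, Matrix.mulVec_zero, hsl]
        exact congrArg _ (hb₁ j _).symm
      · erw [hb₂ j a, mulVec_elim_of_even he, (h₂ j a).2.2, Matrix.mulVec_zero, hsr]
        exact congrArg _ (hb₂ j _).symm)
  refine ⟨r₁, r₂, d₁, d₂, changeBasis b, hα, hβ, ?_, ?_, trace_changeBasis b, hE, hX, hF, ?_⟩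
  · rintro (j | j)
    · exact α.parts_pos (hα ▸ Multiset.mem_map_of_mem d₁ (Finset.mem_univ j))
    · exact β.parts_pos (hβ ▸ Multiset.mem_map_of_mem d₂ (Finset.mem_univ j))
  · rintro (j | j) <;> simp
  · have hsgn : ∀ i, signMatrix.mulVec (b i) =
        (Sum.elim (fun _ => 1) (fun _ => -1) i.1 : ℂ) • b i := by
      rintro ⟨j | j, a⟩
      · erw [hb₁ j a]
        simp [signMatrix, Matrix.fromBlocks_mulVec]
      · erw [hb₂ j a]
        ext (u | u) <;> simp [signMatrix, Matrix.fromBlocks_mulVec, Matrix.neg_mulVec]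
    ext i k
    rw [changeBasis_apply, hsgn, map_smul, Module.Basis.repr_self, Finsupp.smul_apply, smul_eq_mul,
      matS, Matrix.diagonal_apply, Finsupp.single_apply]
    by_cases h : i = k
    · subst h; simp
    · rw [if_neg h, if_neg (Ne.symm h), mul_zero]

section StandardForm

variable {J : Type*} [Fintype J] [DecidableEq J] {d : J → ℕ} {s : J → ℂ}
  {Ψ : SuperMatrix m n ≃ₐ[ℂ] Mat d} {e x f : slSpace m n}

theorem coe_sl_bracket (a b : slSpace m n) :
    ((sl m n).bracket a b : SuperMatrix m n) = superBracket (a : SuperMatrix m n) b := rfl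

theorem mem_sl_part {i : ZMod 2} {a : slSpace m n} :
    a ∈ (sl m n).part i ↔ (a : SuperMatrix m n) ∈ part i := Iff.rfl

theorem sl_bracket_of_even {a : slSpace m n} (ha : a ∈ (sl m n).part 0) (b : slSpace m n) :
    ((sl m n).bracket a b : SuperMatrix m n) = a.1 * b.1 - b.1 * a.1 := by
  rw [coe_sl_bracket, superBracket_of_even (mem_sl_part.1 ha)]

theorem sl_bracket_eq_zero_iff {a : slSpace m n} (ha : a ∈ (sl m n).part 0) (b : slSpace m n)
    (Ψ : SuperMatrix m n ≃ₐ[ℂ] Mat d) :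
    (sl m n).bracket a b = 0 ↔ Commute (Ψ a) (Ψ b) := by
  rw [← Subtype.coe_inj, sl_bracket_of_even ha, Submodule.coe_zero, sub_eq_zero, commute_iff_eq,
    ← map_mul, ← map_mul, Ψ.injective.eq_iff]

theorem IsStandardForm.supertrace_eq {e x f : SuperMatrix m n} (h : IsStandardForm s Ψ e x f)
    (a : SuperMatrix m n) : supertrace a = Matrix.trace (matS s * Ψ a) := by
  rw [supertrace_eq_trace, ← h.map_sign, ← map_mul, h.trace]

/-- The element of `sl(m|n)` whose standard form is a given supertraceless matrix. -/
def IsStandardForm.lift {e x f : SuperMatrix m n} (h : IsStandardForm s Ψ e x f) (M : Mat d)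
    (hM : Matrix.trace (matS s * M) = 0) : slSpace m n :=
  ⟨Ψ.symm M, by
    change supertrace _ = 0
    rw [h.supertrace_eq, AlgEquiv.apply_symm_apply, hM]⟩

theorem IsStandardForm.map_lift {e x f : SuperMatrix m n} (h : IsStandardForm s Ψ e x f)
    (M : Mat d) (hM : Matrix.trace (matS s * M) = 0) : Ψ (h.lift M hM) = M :=
  Ψ.apply_symm_apply M

theorem IsStandardForm.trace_eq_zero {e x f : SuperMatrix m n} (h : IsStandardForm s Ψ e x f)
    (a : slSpace m n) : Matrix.trace (matS s * Ψ a) = 0 :=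
  (h.supertrace_eq a).symm.trans a.2

theorem IsStandardForm.mem_natural_iff (h : IsStandardForm s Ψ e.1 x.1 f.1)
    (ht : (sl m n).IsEvenSl2Triple e x f) (z : slSpace m n) :
    z ∈ (sl m n).natural e x f ↔ Centralizes (Ψ z) := by
  simp only [LieSuperalgebra.natural, Submodule.mem_inf, LinearMap.mem_ker,
    sl_bracket_eq_zero_iff ht.e_even z Ψ, sl_bracket_eq_zero_iff ht.x_even z Ψ,
    sl_bracket_eq_zero_iff ht.f_even z Ψ, h.map_e, h.map_x, h.map_f, Centralizes, and_assoc,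
    Commute.symm_iff (b := Ψ z)]

/-- The isomorphism between the two summands is supertraceless, being off-diagonal, and lies in the
centralizer. It is therefore even, i.e. it commutes with the sign matrix. -/
theorem IsStandardForm.sign_eq (h : IsStandardForm s Ψ e.1 x.1 f.1)
    (ht : (sl m n).IsEvenSl2Triple e x f) (hnat : (sl m n).natural e x f ≤ (sl m n).part 0)
    (j k : J) (hd : d j = d k) : s j = s k := by
  by_cases hjk : j = k
  · rw [hjk]
  let z := h.lift (blockUnit j k) (trace_matS_mul_blockUnit s hjk)
  have hz : Ψ z = blockUnit j k := h.map_lift _ _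
  have hev := mem_part_zero_iff_commute.1 (mem_sl_part.1 (hnat ((h.mem_natural_iff ht z).2
    (hz ▸ centralizes_blockUnit hd))))
  refine eq_of_commute_matS hd (h.pos j) ?_
  rw [← hz, ← h.map_sign]
  exact hev.map Ψ

/-- The linear map sending an element of `sl(m|n)` to its standard form. -/
def standardMap (Ψ : SuperMatrix m n ≃ₐ[ℂ] Mat d) : slSpace m n →ₗ[ℂ] Mat d :=
  Ψ.toLinearMap ∘ₗ (slSpace m n).subtype

theorem standardMap_injective (Ψ : SuperMatrix m n ≃ₐ[ℂ] Mat d) :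
    Function.Injective (standardMap Ψ) :=
  fun _ _ h => Subtype.ext (Ψ.injective h)

/-- The adjoint exchanges `e` and `f`, fixes `x`, and preserves the centralizer within `sl(m|n)`. -/
theorem IsStandardForm.hasStableComplements (h : IsStandardForm s Ψ e.1 x.1 f.1)
    (ht : (sl m n).IsEvenSl2Triple e x f) (hnat : (sl m n).natural e x f ≤ (sl m n).part 0) :
    HasStableComplements ((sl m n).actingOperators e x f) := by
  have key : ∀ a a' : slSpace m n, a ∈ (sl m n).part 0 → a' ∈ (sl m n).part 0 →
      Ψ a' = adj (Ψ a) → ∀ v w : slSpace m n, (innerCore d).inner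
        (Ψ ((sl m n).bracket a' v : slSpace m n)) (Ψ w) =
          (innerCore d).inner (Ψ v) (Ψ ((sl m n).bracket a w : slSpace m n)) := by
    intro a a' ha ha' haa v w
    rw [sl_bracket_of_even ha, sl_bracket_of_even ha', map_sub, map_sub, map_mul, map_mul, map_mul,
      map_mul, haa, innerCore_adj]
  refine HasStableComplements.of_adjoint ((innerCore d).pullback
    (standardMap Ψ) (standardMap_injective Ψ)) ?_
  rintro T (⟨z, hz, rfl⟩ | rfl | rfl | rfl)
  · let z' := h.lift (adj (Ψ z)) (by
      rw [trace_matS_mul_adj h.sign, h.trace_eq_zero z, star_zero])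
    have hz' : Ψ z' = adj (Ψ z) := h.map_lift _ _
    have hn : z' ∈ (sl m n).natural e x f :=
      (h.mem_natural_iff ht z').2 (hz' ▸ ((h.mem_natural_iff ht z).1 hz).adj)
    exact ⟨(sl m n).bracket z', Or.inl ⟨z', hn, rfl⟩, key z z' (hnat hz) (hnat hn) hz'⟩
  · exact ⟨(sl m n).bracket f, Or.inr (by simp), key e f ht.e_even ht.f_even (by rw [h.map_e, h.map_f, adj_matE])⟩
  · exact ⟨(sl m n).bracket x, Or.inr (by simp), key x x ht.x_even ht.x_even (by rw [h.map_x, adj_matX])⟩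
  · exact ⟨(sl m n).bracket e, Or.inr (by simp), key f e ht.f_even ht.e_even (by rw [h.map_e, h.map_f, adj_matF])⟩

theorem IsStandardForm.map_highestWeightVectors (h : IsStandardForm s Ψ e.1 x.1 f.1)
    (ht : (sl m n).IsEvenSl2Triple e x f) (hnat : (sl m n).natural e x f ≤ (sl m n).part 0) :
    ((sl m n).highestWeightVectors e x f).map (standardMap Ψ) =
      highestWeight s := by
  have hmem : ∀ v : slSpace m n, v ∈ (sl m n).highestWeightVectors e x f ↔
      Ψ v ∈ highestWeight s := by
    intro v
    refine and_congr ⟨fun hv Z hZ htr => ?_, fun hv z hz => ?_⟩ (and_congr ?_ ?_)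
    · have hz := h.map_lift Z htr
      have hn := (h.mem_natural_iff ht (h.lift Z htr)).2 (hz.symm ▸ hZ)
      rw [← hz]
      exact (sl_bracket_eq_zero_iff (hnat hn) v Ψ).1 (hv _ hn)
    · exact (sl_bracket_eq_zero_iff (hnat hz) v Ψ).2
        (hv _ ((h.mem_natural_iff ht z).1 hz) (h.trace_eq_zero z))
    · rw [sl_bracket_eq_zero_iff ht.e_even v Ψ, h.map_e]
    · rw [← Subtype.coe_inj, sl_bracket_of_even ht.x_even, ← h.map_x, ← map_mul, ← map_mul,
        ← map_sub, Ψ.injective.eq_iff]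
  apply le_antisymm
  · rintro _ ⟨v, hv, rfl⟩
    exact (hmem v).1 hv
  · intro M hM
    -- A matrix of weight `1` equals its commutator with the even element `x`, so its supertrace
    -- vanishes and it comes from `sl(m|n)`.
    have htr : Matrix.trace (matS s * M) = 0 := by
      have hc : Commute (matS s) (matX d) := commute_diagonal _ _
      rw [← hM.2.2, mul_sub, trace_sub, ← mul_assoc, ← mul_assoc, hc.eq, mul_assoc,
        trace_mul_comm (matX d), sub_self]
    exact ⟨h.lift M htr, (hmem _).2 ((h.map_lift M htr).symm ▸ hM), h.map_lift M htr⟩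

theorem IsStandardForm.finrank_highestWeightVectors (h : IsStandardForm s Ψ e.1 x.1 f.1)
    (ht : (sl m n).IsEvenSl2Triple e x f) (hnat : (sl m n).natural e x f ≤ (sl m n).part 0) :
    Module.finrank ℂ ((sl m n).highestWeightVectors e x f) = (bigDims d).card := by
  rw [← finrank_highestWeight h.pos h.sign (h.sign_eq ht hnat), ← h.map_highestWeightVectors ht hnat]
  exact (Submodule.equivMapOfInjective _ (standardMap_injective Ψ) _).finrank_eq

end StandardForm

theorem sl_summary {e x f : slSpace m n} {α : m.Partition} {β : n.Partition}
    (ht : (sl m n).IsEvenSl2Triple e x f) (henc : IsEncodedBy e.1 x.1 f.1 α β)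
    (hnat : (sl m n).natural e x f ≤ (sl m n).part 0) :
    HasStableComplements ((sl m n).actingOperators e x f) ∧
      Module.finrank ℂ ((sl m n).highestWeightVectors e x f) = numBigParts α β ∧
      Disjoint α.parts β.parts := by
  obtain ⟨r₁, r₂, d₁, d₂, Ψ, hα, hβ, h⟩ :=
    exists_isStandardForm ht.e_even ht.x_even ht.f_even henc
  refine ⟨h.hasStableComplements ht hnat, ?_, ?_⟩
  · rw [h.finrank_highestWeightVectors ht hnat, numBigParts, bigDims]
    congr 2
    ext q
    simp [← hα, ← hβ]
  · rw [Multiset.disjoint_left]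
    intro p h₁ h₂
    rw [← hα, Multiset.mem_map] at h₁
    rw [← hβ, Multiset.mem_map] at h₂
    obtain ⟨i, -, hi⟩ := h₁
    obtain ⟨k, -, hk⟩ := h₂
    have := h.sign_eq ht hnat (Sum.inl i) (Sum.inr k) (hi.trans hk.symm)
    norm_num at this

/-! ### Passage from `sl(m|m)` to `psl(m|m)` -/

section Psl

variable {m : ℕ} {e x f : slSpace m m}

theorem psl_bracket (a b : slSpace m m) : (psl m).bracket ((scalars m).mkQ a) ((scalars m).mkQ b) =
    (scalars m).mkQ ((sl m m).bracket a b) := rfl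

theorem mkQ_eq_zero_iff {a : slSpace m m} :
    (scalars m).mkQ a = 0 ↔ ∃ c : ℂ, c • (1 : SuperMatrix m m) = a := by
  rw [Submodule.mkQ_apply, Submodule.Quotient.mk_eq_zero, scalars, Submodule.mem_comap,
    Submodule.mem_span_singleton]
  rfl

/-- The bracket is a commutator of matrices, of trace zero, while a scalar `c` has trace `2mc`. For
`m = 0` the whole space is zero. -/
theorem sl_bracket_eq_zero_of_mkQ {a : slSpace m m} (ha : a ∈ (sl m m).part 0) {b : slSpace m m}
    (h : (scalars m).mkQ ((sl m m).bracket a b) = 0) : (sl m m).bracket a b = 0 := by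
  obtain ⟨c, hc⟩ := mkQ_eq_zero_iff.1 h
  apply Subtype.ext
  rcases Nat.eq_zero_or_pos m with rfl | hm
  · exact Subsingleton.elim _ _
  · have htr := congrArg Matrix.trace hc
    rw [sl_bracket_of_even ha, trace_sub, trace_mul_comm, sub_self, trace_smul, trace_one] at htr
    have hne : ((Fintype.card (Fin m ⊕ Fin m) : ℕ) : ℂ) ≠ 0 := by
      rw [Nat.cast_ne_zero]
      simp
      omega
    have hc0 : c = 0 := (mul_eq_zero.1 htr).resolve_right hne
    rw [← hc, hc0, zero_smul]
    rfl

theorem natural_psl (ht : (sl m m).IsEvenSl2Triple e x f) :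
    (psl m).natural ((scalars m).mkQ e) ((scalars m).mkQ x) ((scalars m).mkQ f) =
      ((sl m m).natural e x f).map (scalars m).mkQ := by
  apply le_antisymm
  · intro z hz
    obtain ⟨z, rfl⟩ := (scalars m).mkQ_surjective z
    exact ⟨z, ⟨⟨sl_bracket_eq_zero_of_mkQ ht.e_even hz.1.1,
      sl_bracket_eq_zero_of_mkQ ht.x_even hz.1.2⟩, sl_bracket_eq_zero_of_mkQ ht.f_even hz.2⟩, rfl⟩
  · rintro _ ⟨z, ⟨⟨h1, h2⟩, h3⟩, rfl⟩
    refine ⟨⟨?_, ?_⟩, ?_⟩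
    · exact (congrArg (scalars m).mkQ h1).trans (map_zero _)
    · exact (congrArg (scalars m).mkQ h2).trans (map_zero _)
    · exact (congrArg (scalars m).mkQ h3).trans (map_zero _)

theorem mem_part_zero_of_mkQ {z : slSpace m m} (h : (scalars m).mkQ z ∈ (psl m).part 0) :
    z ∈ (sl m m).part 0 := by
  obtain ⟨y, hy, hyz⟩ := h
  have h0 : (scalars m).mkQ (z - y) = 0 := by rw [map_sub, hyz, sub_self]
  obtain ⟨c, hc⟩ := mkQ_eq_zero_iff.1 h0
  have h1 : z - y ∈ (sl m m).part 0 := by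
    rw [mem_sl_part, ← hc]
    exact Submodule.smul_mem _ _ one_mem_part
  simpa using Submodule.add_mem _ h1 hy

theorem natural_sl_le_of_psl (ht : (sl m m).IsEvenSl2Triple e x f)
    (hnat : (psl m).natural ((scalars m).mkQ e) ((scalars m).mkQ x) ((scalars m).mkQ f) ≤
      (psl m).part 0) : (sl m m).natural e x f ≤ (sl m m).part 0 := by
  intro z hz
  exact mem_part_zero_of_mkQ (hnat (natural_psl ht ▸ Submodule.mem_map_of_mem hz))

theorem hasStableComplements_psl (ht : (sl m m).IsEvenSl2Triple e x f)
    (h : HasStableComplements ((sl m m).actingOperators e x f)) :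
    HasStableComplements ((psl m).actingOperators ((scalars m).mkQ e) ((scalars m).mkQ x)
      ((scalars m).mkQ f)) := by
  refine h.quotient ?_ ?_
  · rintro T (⟨z, hz, rfl⟩ | rfl | rfl | rfl)
    · exact ⟨_, Or.inl ⟨_, natural_psl ht ▸ Submodule.mem_map_of_mem hz, rfl⟩, fun v => rfl⟩
    · exact ⟨_, Or.inr (Or.inl rfl), fun v => rfl⟩
    · exact ⟨_, Or.inr (Or.inr (Or.inl rfl)), fun v => rfl⟩
    · exact ⟨_, Or.inr (Or.inr (Or.inr rfl)), fun v => rfl⟩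
  · rintro T (⟨z, hz, rfl⟩ | rfl | rfl | rfl)
    · rw [natural_psl ht] at hz
      obtain ⟨z, hz, rfl⟩ := hz
      exact ⟨_, Or.inl ⟨_, hz, rfl⟩, fun v => rfl⟩
    · exact ⟨_, Or.inr (Or.inl rfl), fun v => rfl⟩
    · exact ⟨_, Or.inr (Or.inr (Or.inl rfl)), fun v => rfl⟩
    · exact ⟨_, Or.inr (Or.inr (Or.inr rfl)), fun v => rfl⟩

theorem sl_bracket_scalar (a : slSpace m m) {b : slSpace m m} {c : ℂ}
    (hb : c • (1 : SuperMatrix m m) = b) : (sl m m).bracket a b = 0 := by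
  apply Subtype.ext
  rw [coe_sl_bracket, ← hb, map_smul, (superBracket_one _).1, smul_zero]
  rfl

/-- Conditions that a bracket vanish lift to `sl(m|m)` automatically; the weight condition `[x, v] =
v` lifts only up to a scalar and needs a change of representative. -/
theorem highestWeightVectors_psl (ht : (sl m m).IsEvenSl2Triple e x f)
    (hnat : (sl m m).natural e x f ≤ (sl m m).part 0) :
    (psl m).highestWeightVectors ((scalars m).mkQ e) ((scalars m).mkQ x) ((scalars m).mkQ f) =
      ((sl m m).highestWeightVectors e x f).map (scalars m).mkQ := by
  apply le_antisymm
  · rintro v ⟨hz, he, hx⟩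
    obtain ⟨v, rfl⟩ := (scalars m).mkQ_surjective v
    rw [psl_bracket] at he hx
    have hx0 : (scalars m).mkQ ((sl m m).bracket x v - v) = 0 := by rw [map_sub, hx, sub_self]
    obtain ⟨c, hc⟩ := mkQ_eq_zero_iff.1 hx0
    have hbr : ∀ a, (sl m m).bracket a ((sl m m).bracket x v) = (sl m m).bracket a v := by
      intro a
      rw [← sub_eq_zero, ← map_sub]
      exact sl_bracket_scalar a hc
    -- Since `[x, v] - v` is scalar, hence central, `[x, v]` represents the same class and satisfies
    -- `[x, [x, v]] = [x, v]` exactly.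
    refine ⟨(sl m m).bracket x v, ⟨fun z hzn => ?_, ?_, hbr x⟩, hx⟩
    · rw [hbr]
      exact sl_bracket_eq_zero_of_mkQ (hnat hzn)
        (hz _ (natural_psl ht ▸ Submodule.mem_map_of_mem hzn))
    · rw [hbr]
      exact sl_bracket_eq_zero_of_mkQ ht.e_even he
  · rintro _ ⟨v, ⟨hz, he, hx⟩, rfl⟩
    refine ⟨fun z hzn => ?_, ?_, ?_⟩
    · rw [natural_psl ht] at hzn
      obtain ⟨z, hzn, rfl⟩ := hzn
      rw [psl_bracket, hz z hzn, map_zero]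
    · rw [psl_bracket, he, map_zero]
    · rw [psl_bracket, hx]

theorem finrank_highestWeightVectors_psl (ht : (sl m m).IsEvenSl2Triple e x f)
    (hnat : (sl m m).natural e x f ≤ (sl m m).part 0) :
    Module.finrank ℂ ((psl m).highestWeightVectors ((scalars m).mkQ e) ((scalars m).mkQ x)
      ((scalars m).mkQ f)) = Module.finrank ℂ ((sl m m).highestWeightVectors e x f) := by
  have hinj : Function.Injective
      ((scalars m).mkQ.domRestrict ((sl m m).highestWeightVectors e x f)) := by
    refine (injective_iff_map_eq_zero _).2 ?_
    rintro ⟨v, hv⟩ h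
    obtain ⟨c, hc⟩ := mkQ_eq_zero_iff.1 h
    -- A scalar `v` of weight `1` satisfies `v = [x, v] = 0`.
    exact Subtype.ext (hv.2.2.symm.trans (sl_bracket_scalar x hc))
  rw [highestWeightVectors_psl ht hnat, ← LinearMap.range_domRestrict,
    LinearMap.finrank_range_of_inj hinj]

end Psl

end SuperMatrix

/-! ### Disjoint pairs of partitions with one part size greater than `1` -/

section Partitions

variable {m n : ℕ}

theorem Nat.Partition.parts_eq_replicate_add {α : m.Partition} {q : ℕ} (hq : 2 ≤ q)
    (h : ∀ p ∈ α.parts, p = q ∨ p = 1) : α.parts =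
      Multiset.replicate (α.parts.count q) q + Multiset.replicate (α.parts.count 1) 1 := by
  ext p
  rw [Multiset.count_add, Multiset.count_replicate, Multiset.count_replicate]
  by_cases hp : p ∈ α.parts
  · rcases h p hp with rfl | rfl
    · rw [if_pos rfl, if_neg (by omega), add_zero]
    · rw [if_neg (by omega), if_pos rfl, zero_add]
  · rw [Multiset.count_eq_zero_of_notMem hp]
    split_ifs with h1 h2 h2
    · omega
    · subst h1; simp [hp]
    · subst h2; simp [hp]
    · rfl

theorem Nat.Partition.eq_of_parts_eq_replicate_add {α : m.Partition} {q l r : ℕ}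
    (h : α.parts = Multiset.replicate l q + Multiset.replicate r 1) : m = q * l + r := by
  rw [← α.parts_sum, h]
  simp [mul_comm]

/-- The parts of `α` and `β` when `q ≥ 2`, a part of `α`, is the only part greater than `1` of the
pair, and `α` and `β` have no common part. -/
theorem parts_of_bigPart {α : m.Partition} {β : n.Partition} {q : ℕ} (hq : 2 ≤ q)
    (hqα : q ∈ α.parts) (hα : ∀ p ∈ α.parts, p = q ∨ p = 1) (hβ : ∀ p ∈ β.parts, p = q ∨ p = 1)
    (hd : Disjoint α.parts β.parts) : ∃ l, 1 ≤ l ∧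
      ((∃ r, m = q * l + r ∧ n = 0 ∧
        α.parts = Multiset.replicate l q + Multiset.replicate r 1 ∧ β.parts = 0) ∨
      (m = q * l ∧ α.parts = Multiset.replicate l q ∧ β.parts = Multiset.replicate n 1)) := by
  have hdis : ∀ {p}, p ∈ α.parts → p ∉ β.parts := Multiset.disjoint_left.1 hd
  have hα' := Nat.Partition.parts_eq_replicate_add hq hα
  have hβ' : β.parts = Multiset.replicate n 1 := by
    have h1 := Nat.Partition.parts_eq_replicate_add hq hβ
    rw [Multiset.count_eq_zero_of_notMem (hdis hqα)] at h1
    have h2 := Nat.Partition.eq_of_parts_eq_replicate_add h1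
    rw [mul_zero, zero_add] at h2
    rw [← h2] at h1
    simpa using h1
  refine ⟨α.parts.count q, Multiset.one_le_count_iff_mem.2 hqα, ?_⟩
  -- If `n > 0` then `1` is a part of `β`, so disjointness excludes it from `α`; if `n = 0` the
  -- number of parts `1` in `α` is free.
  rcases Nat.eq_zero_or_pos n with rfl | hn
  · exact Or.inl ⟨_, Nat.Partition.eq_of_parts_eq_replicate_add hα', rfl, hα', by simp⟩
  · have h1 : (1 : ℕ) ∉ α.parts := fun h => hdis h (by
      rw [hβ', Multiset.mem_replicate]; exact ⟨hn.ne', rfl⟩)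
    rw [Multiset.count_eq_zero_of_notMem h1] at hα'
    have h2 := Nat.Partition.eq_of_parts_eq_replicate_add hα'
    exact Or.inr ⟨by simpa using h2, by simpa using hα', hβ'⟩

/-- Disjointness serves only the direction towards the list; every listed pair visibly has `q` as
its one part size greater than `1`. -/
theorem numBigParts_eq_one_iff {α : m.Partition} {β : n.Partition}
    (hd : Disjoint α.parts β.parts) : numBigParts α β = 1 ↔ IsListedPair α β := by
  rw [numBigParts, Finset.card_eq_one]
  constructor
  · rintro ⟨q, hq⟩
    have hmem : ∀ p, ((p ∈ α.parts ∨ p ∈ β.parts) ∧ 1 < p) ↔ p = q := by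
      intro p
      have := congrArg (p ∈ ·) hq
      simpa using this
    obtain ⟨hqm, hq2⟩ := (hmem q).2 rfl
    have hα : ∀ p ∈ α.parts, p = q ∨ p = 1 := by
      intro p hp
      have := α.parts_pos hp
      by_cases h1 : 1 < p
      · exact Or.inl ((hmem p).1 ⟨Or.inl hp, h1⟩)
      · right; omega
    have hβ : ∀ p ∈ β.parts, p = q ∨ p = 1 := by
      intro p hp
      have := β.parts_pos hp
      by_cases h1 : 1 < p
      · exact Or.inl ((hmem p).1 ⟨Or.inr hp, h1⟩)
      · right; omega
    rcases hqm with hqα | hqβ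
    · obtain ⟨l, hl, ⟨r, h1, h2, h3, h4⟩ | ⟨h1, h2, h3⟩⟩ := parts_of_bigPart hq2 hqα hα hβ hd
      · exact ⟨q, l, hq2, hl, Or.inl ⟨r, h1, h2, h3, h4⟩⟩
      · exact ⟨q, l, hq2, hl, Or.inr (Or.inr (Or.inl ⟨h1, h2, h3⟩))⟩
    · obtain ⟨l, hl, ⟨r, h1, h2, h3, h4⟩ | ⟨h1, h2, h3⟩⟩ := parts_of_bigPart hq2 hqβ hβ hα hd.symm
      · exact ⟨q, l, hq2, hl, Or.inr (Or.inl ⟨r, h2, h1, h4, h3⟩)⟩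
      · exact ⟨q, l, hq2, hl, Or.inr (Or.inr (Or.inr ⟨h1, h3, h2⟩))⟩
  · rintro ⟨q, l, hq, hl, h⟩
    refine ⟨q, ?_⟩
    ext p
    rcases h with ⟨r, -, -, h1, h2⟩ | ⟨r, -, -, h1, h2⟩ | ⟨-, h1, h2⟩ | ⟨-, h1, h2⟩ <;>
    · simp only [h1, h2, Finset.mem_filter, Finset.mem_union, Multiset.mem_toFinset,
        Multiset.mem_add, Multiset.mem_replicate, Multiset.notMem_zero, Finset.mem_singleton, or_false, false_or]
      omega

end Partitions

end

/-! ### The main theorem -/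

theorem mainTheorem6 :
    (∀ (m n : ℕ), m ≠ n → ∀ (e x f : SuperMatrix.slSpace m n) (α : m.Partition) (β : n.Partition),
      (SuperMatrix.sl m n).IsEvenSl2Triple e x f →
      IsEncodedBy e.1 x.1 f.1 α β →
      (SuperMatrix.sl m n).natural e x f ≤ (SuperMatrix.sl m n).part 0 →
      (SuperMatrix.sl m n).MultTrivAdjEq e x f (numBigParts α β) ∧
        ((SuperMatrix.sl m n).MultTrivAdjEq e x f 1 ↔ IsListedPair α β)) ∧
    (∀ (m : ℕ) (e x f : SuperMatrix.slSpace m m ⧸ SuperMatrix.scalars m) (α β : m.Partition),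
      (SuperMatrix.psl m).IsEvenSl2Triple e x f →
      IsEncodedByPsl e x f α β →
      (SuperMatrix.psl m).natural e x f ≤ (SuperMatrix.psl m).part 0 →
      (SuperMatrix.psl m).MultTrivAdjEq e x f (numBigParts α β) ∧
        ((SuperMatrix.psl m).MultTrivAdjEq e x f 1 ↔ IsListedPair α β)) := by
  constructor
  · intro m n _ e x f α β ht henc hnat
    obtain ⟨hc, hrank, hd⟩ := SuperMatrix.sl_summary ht henc hnat
    rw [ht.multTrivAdjEq_iff hnat hc, ht.multTrivAdjEq_iff hnat hc, hrank,
      numBigParts_eq_one_iff hd]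
    exact ⟨rfl, Iff.rfl⟩
  -- The lifted triple `ht'` feeds the computation in `sl(m|m)`, while `ht` in the quotient feeds
  -- the multiplicity count.
  · rintro m _ _ _ α β ht ⟨e, x, f, rfl, rfl, rfl, ht', henc⟩ hnat
    have hnat' := SuperMatrix.natural_sl_le_of_psl ht' hnat
    obtain ⟨hc, hrank, hd⟩ := SuperMatrix.sl_summary ht' henc hnat'
    have hc' := SuperMatrix.hasStableComplements_psl ht' hc
    rw [ht.multTrivAdjEq_iff hnat hc', ht.multTrivAdjEq_iff hnat hc',
      SuperMatrix.finrank_highestWeightVectors_psl ht' hnat', hrank, numBigParts_eq_one_iff hd]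
    exact ⟨rfl, Iff.rfl⟩
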